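/- Let $\mathcal X,\mathcal Y$ (inputs) and $\mathcal A,\mathcal B$ (outcomes) be finite sets. A conditional distribution $\mathbf p=(p(a,b|x,y))$ is non-signaling if $\sum_b p(a,b|x,y)$ does not depend on $y$ and $\sum_a p(a,b|x,y)$ does not depend on $x$. It is local if it is a convex combination of distributions of the form $\delta_{a=\lambda_A(x)}\,\delta_{b=\lambda_B(y)}$ with $\lambda_A:\mathcal X\to\mathcal A$, $\lambda_B:\mathcal Y\to\mathcal B$. It is quantum if there are a Hilbert space, a unit vector $\psi$ in it and projective measurements $(E_a(x))_{a\in\mathcal A}$, $(F_b(y))_{b\in\mathcal B}$ with $E_a(x)F_b(y)=F_b(y)E_a(x)$ such that $p(a,b|x,y)=\langle\psi|E_a(x)F_b(y)|\psi\rangle$. Let $\mathcal L$ and $\mathcal Q$ be the sets of local and of quantum distributions, and define $$\tilde\nu(\mathbf p)=\inf\Big\{\sum_i|q_i| : \mathbf p=\sum_i q_i\mathbf p_i,\ q_i\in\mathbb R,\ \mathbf p_i\in\mathcal L\Big\},\qquad \tilde\gamma_2(\mathbf p)=\inf\Big\{\sum_i|q_i| : \mathbf p=\sum_i q_i\mathbf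 p_i,\ q_i\in\mathbb R,\ \mathbf p_i\in\mathcal Q\Big\},$$ the sums being finite. Suppose that Alice receives $x$, Bob receives $y$, and after communicating they must output $a$ and $b$ distributed exactly according to $p(a,b|x,y)$. Let $R_0^{\mathrm{pub}}(\mathbf p)$ be the least number of bits, in the worst case, exchanged by a classical two-way protocol with shared randomness that achieves this, and $Q_0^{\mathrm{ent}}(\mathbf p)$ the least number of qubits exchanged by a two-way quantum protocol with arbitrary shared entanglement that achieves this. In the quantum model the operations of a player act on the player's part of the shared entangled system and on the message qubits that the player currently holds, and locality is expressed, as for $\mathcal Q$, by commutation of operators on different parts; this includes the tensor product model with registers of any dimension. For $C:\mathcal X\times\mathcal Y\to[-1,1]$ write $R_0^{\mathrm{pub}}(C)$, $Q_0^{\mathrm{ent}}(C)$, $\tilde\nu(C)$, $\tilde\gamma_2(C)$ for the corresponding quantities of the distribution $p(a,b|x,y)=\frac14(1+ab\,C(x,y))$ on $a,b\in\{\pm1\}$, which has correlations $C$ and uniform marginals. Theorem. Let $\mathbf p$ be a non-signaling distribution over $\mathcal A\times\mathcal B$ with input set $\mathcal X\times\mathcal Y$, let $C:\mathcal X\times\mathcal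 Y\to[-1,1]$, and let $t,q\ge 0$ be integers. 1. If $R_0^{\mathrm{pub}}(\mathbf p)\le t$, then $\tilde\nu(\mathbf p)\le 2^{t+1}-1$. 2. If $R_0^{\mathrm{pub}}(C)\le t$, then $\tilde\nu(C)\le 2^{t}$. 3. If $Q_0^{\mathrm{ent}}(\mathbf p)\le q$, then $\tilde\gamma_2(\mathbf p)\le 2^{2q+1}-1$. 4. If $Q_0^{\mathrm{ent}}(C)\le q$, then $\tilde\gamma_2(C)\le 2^{q}$. -/

import Mathlib

open MeasureTheory

noncomputable section

/-! ### Bipartite conditional distributions -/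

/-- A family of numbers `p x y a b`, read as `p(a,b|x,y)`. -/
abbrev Behavior (X Y A B : Type*) := X → Y → A → B → ℝ

/-- `p` is a non-signaling conditional probability distribution. -/
structure IsNonSignaling {X Y A B : Type*} [Fintype A] [Fintype B]
    (p : Behavior X Y A B) : Prop where
  nonneg : ∀ x y a b, 0 ≤ p x y a b
  sum_eq_one : ∀ x y, ∑ a, ∑ b, p x y a b = 1
  marginal_alice : ∀ a x y y', ∑ b, p x y a b = ∑ b, p x y' a b
  marginal_bob : ∀ b x x' y, ∑ a, p x y a b = ∑ a, p x' y a b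

/-- The distribution over outcomes `±1` with correlations `C` and uniform marginals. -/
def ofCorrelation {X Y : Type*} (C : X → Y → ℝ) : Behavior X Y ℤˣ ℤˣ :=
  fun x y a b => (1 + ((a : ℤ) : ℝ) * ((b : ℤ) : ℝ) * C x y) / 4

/-! ### Local and quantum distributions -/

def localDeterministic {X Y A B : Type*} [DecidableEq A] [DecidableEq B]
    (f : X → A) (g : Y → B) : Behavior X Y A B :=
  fun x y a b => if a = f x ∧ b = g y then 1 else 0

/-- Convex combinations of local deterministic distributions. -/
def localSet (X Y A B : Type*) [DecidableEq A] [DecidableEq B] : Set (Behavior X Y A B) :=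
  convexHull ℝ {p | ∃ (f : X → A) (g : Y → B), p = localDeterministic f g}

/-- `E` is a projective measurement on `H` with outcomes in `A`. -/
structure IsProjectiveMeasurement {A H : Type*} [Fintype A] [NormedAddCommGroup H]
    [InnerProductSpace ℂ H] [CompleteSpace H] (E : A → H →L[ℂ] H) : Prop where
  selfAdjoint : ∀ a, IsSelfAdjoint (E a)
  idem : ∀ a, E a * E a = E a
  orthogonal : ∀ a a', a ≠ a' → E a * E a' = 0
  sum_eq_one : ∑ a, E a = 1

/-- Distributions obtained by measuring a state of an arbitrary Hilbert space with commuting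
projective measurements. -/
def quantumSet (X Y A B : Type*) [Fintype A] [Fintype B] : Set (Behavior X Y A B) :=
  {p | ∃ (H : Type) (_ : NormedAddCommGroup H) (_ : InnerProductSpace ℂ H) (_ : CompleteSpace H)
      (ψ : H) (E : X → A → H →L[ℂ] H) (F : Y → B → H →L[ℂ] H),
      ‖ψ‖ = 1 ∧
      (∀ x, IsProjectiveMeasurement (E x)) ∧
      (∀ y, IsProjectiveMeasurement (F y)) ∧
      (∀ x y a b, Commute (E x a) (F y b)) ∧
      ∀ x y a b, (p x y a b : ℂ) = inner ℂ ψ (E x a (F y b ψ))}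

/-! ### Quality of the best affine model -/

/-- Infimum of `∑ |wᵢ|` over all finite decompositions `p = ∑ wᵢ pᵢ` with real `wᵢ` and `pᵢ ∈ S`
(`⊤` if there is none). -/
def affineCost {X Y A B : Type*} (S : Set (Behavior X Y A B)) (p : Behavior X Y A B) : EReal :=
  sInf {r | ∃ (n : ℕ) (w : Fin n → ℝ) (P : Fin n → Behavior X Y A B),
    (∀ i, P i ∈ S) ∧ p = ∑ i, w i • P i ∧ r = ((∑ i, |w i| : ℝ) : EReal)}

def nuTilde {X Y A B : Type*} [DecidableEq A] [DecidableEq B] (p : Behavior X Y A B) : EReal :=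
  affineCost (localSet X Y A B) p

def gammaTwoTilde {X Y A B : Type*} [Fintype A] [Fintype B] (p : Behavior X Y A B) : EReal :=
  affineCost (quantumSet X Y A B) p

/-! ### Classical communication with shared randomness -/

/-- Deterministic two-party protocol trees. At an inner node the owner sends one bit computed from
their input; at a leaf each player produces an outcome from their input. -/
inductive ProtocolTree (X Y A B : Type*) where
  | output (f : X → A) (g : Y → B) : ProtocolTree X Y A B
  | alice (m : X → Bool) (next : Bool → ProtocolTree X Y A B) : ProtocolTree X Y A B
  | bob (m : Y → Bool) (next : Bool → ProtocolTree X Y A B) : ProtocolTree X Y A B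

namespace ProtocolTree

/-- The pair of outcomes on inputs `x`, `y`. -/
def run {X Y A B : Type*} (x : X) (y : Y) : ProtocolTree X Y A B → A × B
  | output f g => (f x, g y)
  | alice m next => run x y (next (m x))
  | bob m next => run x y (next (m y))

/-- The number of bits exchanged in the worst case. -/
def depth {X Y A B : Type*} : ProtocolTree X Y A B → ℕ
  | output _ _ => 0
  | alice _ next => max (depth (next false)) (depth (next true)) + 1
  | bob _ next => max (depth (next false)) (depth (next true)) + 1

end ProtocolTree

/-- `p` is produced exactly by a public-coin protocol with at most `t` bits of communication. The
shared random string is a point `ω` of an arbitrary probability space; private coins are part of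
`ω`. -/
def SimulableWithBits {X Y A B : Type*} (p : Behavior X Y A B) (t : ℕ) : Prop :=
  ∃ (Ω : Type) (_ : MeasurableSpace Ω) (μ : Measure Ω) (_ : IsProbabilityMeasure μ)
    (T : Ω → ProtocolTree X Y A B),
    (∀ ω, (T ω).depth ≤ t) ∧
    ∀ x y a b, MeasurableSet {ω | (T ω).run x y = (a, b)} ∧
      p x y a b = μ.real {ω | (T ω).run x y = (a, b)}

/-- Public-coin communication complexity of simulating `p` exactly (`⊤` if impossible). -/
def publicCoinComplexity {X Y A B : Type*} (p : Behavior X Y A B) : ℕ∞ :=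
  sInf {c | ∃ t : ℕ, c = t ∧ SimulableWithBits p t}

/-! ### Quantum communication with shared entanglement -/

inductive Party where
  | alice
  | bob

def Party.other : Party → Party
  | .alice => .bob
  | .bob => .alice

/-- A Hilbert space `H` that holds an entangled system shared by the two players, and `q` message
qubits. Consistently with the definition of quantum distributions, locality is expressed by
commutation: the operators on a player's part of the entangled system form a `*`-algebra
`base P`, the operators on message qubit `j` form a copy `qubit j` of the `2 × 2` matrices, and
operators on different parts commute. The tensor product model is the case
`H = H_A ⊗ (ℂ²)^{⊗q} ⊗ H_B` with `base alice = B(H_A)`, `base bob = B(H_B)`; the registers `H_A`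
and `H_B` may have any dimension and include the players' work space.

Message qubit `j` is the one sent in round `j`, by the player `sender j`. -/
structure MessageSystem (q : ℕ) (H : Type) [NormedAddCommGroup H] [InnerProductSpace ℂ H]
    [CompleteSpace H] where
  base : Party → StarSubalgebra ℂ (H →L[ℂ] H)
  qubit : Fin q → Matrix (Fin 2) (Fin 2) ℂ →⋆ₐ[ℂ] (H →L[ℂ] H)
  sender : Fin q → Party
  commute_base : ∀ S ∈ base .alice, ∀ T ∈ base .bob, Commute S T
  commute_base_qubit : ∀ P, ∀ S ∈ base P, ∀ j M, Commute S (qubit j M)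
  commute_qubit : ∀ i j, i ≠ j → ∀ M N, Commute (qubit i M) (qubit j N)

namespace MessageSystem

/-- The player who holds message qubit `j` after the first `k` transmissions. -/
def holder {q : ℕ} {H : Type} [NormedAddCommGroup H] [InnerProductSpace ℂ H] [CompleteSpace H]
    (M : MessageSystem q H) (k : ℕ) (j : Fin q) : Party :=
  if (j : ℕ) < k then (M.sender j).other else M.sender j

/-- The operators available to a player after the first `k` transmissions: those on the player's
part of the entangled system together with the message qubits that the player holds. -/
def localAlgebra {q : ℕ} {H : Type} [NormedAddCommGroup H] [InnerProductSpace ℂ H]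
    [CompleteSpace H] (M : MessageSystem q H) (P : Party) (k : ℕ) :
    StarSubalgebra ℂ (H →L[ℂ] H) :=
  StarAlgebra.adjoin ℂ
    ((M.base P : Set (H →L[ℂ] H)) ∪ {S | ∃ j, M.holder k j = P ∧ ∃ N, S = M.qubit j N})

end MessageSystem

/-- A protocol in which `q` qubits are sent, starting from an arbitrary shared state. In round
`k < q` each player applies a unitary, chosen according to the player's input, to the part of the
system that the player holds; then qubit `k` goes from its sender to the other player. After the
last round each player measures. -/
structure QuantumProtocol (X Y A B : Type*) [Fintype A] [Fintype B] (q : ℕ) (H : Type)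
    [NormedAddCommGroup H] [InnerProductSpace ℂ H] [CompleteSpace H]
    extends MessageSystem q H where
  init : H
  norm_init : ‖init‖ = 1
  unitaryA : ℕ → X → H →L[ℂ] H
  unitaryB : ℕ → Y → H →L[ℂ] H
  unitaryA_mem : ∀ k < q, ∀ x, unitaryA k x ∈ unitary (H →L[ℂ] H) ∧
    unitaryA k x ∈ toMessageSystem.localAlgebra .alice k
  unitaryB_mem : ∀ k < q, ∀ y, unitaryB k y ∈ unitary (H →L[ℂ] H) ∧
    unitaryB k y ∈ toMessageSystem.localAlgebra .bob k
  measA : X → A → H →L[ℂ] H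
  measB : Y → B → H →L[ℂ] H
  measA_proj : ∀ x, IsProjectiveMeasurement (measA x)
  measB_proj : ∀ y, IsProjectiveMeasurement (measB y)
  measA_mem : ∀ x a, measA x a ∈ toMessageSystem.localAlgebra .alice q
  measB_mem : ∀ y b, measB y b ∈ toMessageSystem.localAlgebra .bob q

namespace QuantumProtocol

/-- The joint state after `k` rounds on inputs `x`, `y`. -/
def state {X Y A B : Type*} [Fintype A] [Fintype B] {q : ℕ} {H : Type} [NormedAddCommGroup H]
    [InnerProductSpace ℂ H] [CompleteSpace H] (Q : QuantumProtocol X Y A B q H) (x : X) (y : Y) :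
    ℕ → H
  | 0 => Q.init
  | k + 1 => Q.unitaryA k x (Q.unitaryB k y (Q.state x y k))

end QuantumProtocol

/-- `p` is produced exactly by an entanglement-assisted protocol that sends `q` qubits. -/
def SimulableWithQubits {X Y A B : Type*} [Fintype A] [Fintype B] (p : Behavior X Y A B)
    (q : ℕ) : Prop :=
  ∃ (H : Type) (_ : NormedAddCommGroup H) (_ : InnerProductSpace ℂ H) (_ : CompleteSpace H)
    (Q : QuantumProtocol X Y A B q H),
    ∀ x y a b, (p x y a b : ℂ) =
      inner ℂ (Q.state x y q) (Q.measA x a (Q.measB y b (Q.state x y q)))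

/-- Entanglement-assisted quantum communication complexity of simulating `p` exactly
(`⊤` if impossible). -/
def entangledComplexity {X Y A B : Type*} [Fintype A] [Fintype B] (p : Behavior X Y A B) : ℕ∞ :=
  sInf {c | ∃ q : ℕ, c = q ∧ SimulableWithQubits p q}

end

/-!
Instead of communicating, the players may guess. In a classical protocol they draw the transcript
from the shared randomness, and each of them aborts if the guess contradicts the player's own
messages; in a quantum protocol they teleport the message qubits, and the sender aborts unless the
outcome is the one which requires no correction. If nobody aborts, the outcomes are distributed as
in the protocol, and this happens with a probability `1 / N` that does not depend on the inputs:
`N = 2 ^ t` for `t` bits, `N = 4 ^ q` for `q` qubits. Hence `p = N • accepted G` where `G` is local,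
resp. quantum, and has an additional outcome on either side.

Let the players output fixed default outcomes when they abort. Then `G` becomes an element of the
set in question, and `N` times this element exceeds `p` by the contribution of the runs in which
someone aborts. Since `p` and `G` are non-signaling, this contribution is a combination of product
distributions of total weight `N - 1`, so the absolute weight is `N + (N - 1)`.

For correlations it is enough to realize `C / N` and `-C / N`. With the value `0` for abortion one
gets `N = 2 ^ t` in the classical case. In the quantum case `N = 2 ^ q` suffices: the observables of
the players map the shared state to vectors whose norms are at most the acceptance amplitudes, with
product `2 ^ (-q)`, and by Tsirelson's theorem these vectors may be rescaled to norm at most `1`.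
-/

noncomputable section

/-! ### Affine models -/

/-- `p` is a finite real combination of elements of `S` with absolute weight at most `r`; for
behaviors this bounds `affineCost S p` by `r`. -/
def HasAffineModel {V : Type*} [AddCommGroup V] [Module ℝ V] (S : Set V) (p : V) (r : ℝ) : Prop :=
  ∃ (n : ℕ) (w : Fin n → ℝ) (P : Fin n → V),
    (∀ i, P i ∈ S) ∧ p = ∑ i, w i • P i ∧ ∑ i, |w i| ≤ r

namespace HasAffineModel

section Module

variable {V : Type*} [AddCommGroup V] [Module ℝ V] {S : Set V} {p p' : V} {r r' : ℝ}

theorem mono (h : HasAffineModel S p r) (hr : r ≤ r') : HasAffineModel S p r' := by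
  obtain ⟨n, w, P, hP, hp, h⟩ := h
  exact ⟨n, w, P, hP, hp, h.trans hr⟩

theorem zero : HasAffineModel S 0 0 :=
  ⟨0, 0, Fin.elim0, fun i => i.elim0, by simp, by simp⟩

theorem smul_of_mem (h : p ∈ S) (c : ℝ) : HasAffineModel S (c • p) |c| :=
  ⟨1, fun _ => c, fun _ => p, fun _ => h, by simp, by simp⟩

theorem neg (h : HasAffineModel S p r) : HasAffineModel S (-p) r := by
  obtain ⟨n, w, P, hP, rfl, hr⟩ := h
  exact ⟨n, -w, P, hP, by simp, by simpa using hr⟩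

theorem add (h : HasAffineModel S p r) (h' : HasAffineModel S p' r') :
    HasAffineModel S (p + p') (r + r') := by
  obtain ⟨n, w, P, hP, rfl, hr⟩ := h
  obtain ⟨n', w', P', hP', rfl, hr'⟩ := h'
  refine ⟨n + n', Fin.append w w', Fin.append P P', fun i => ?_, ?_, ?_⟩
  · refine Fin.addCases (fun i => ?_) (fun i => ?_) i
    · simpa using hP i
    · simpa using hP' i
  · simp [Fin.sum_univ_add]
  · simpa [Fin.sum_univ_add] using add_le_add hr hr'

end Module

theorem affineCost_le {X Y A B : Type*} {S : Set (Behavior X Y A B)} {p : Behavior X Y A B}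
    {r : ℝ} (h : HasAffineModel S p r) : affineCost S p ≤ (r : EReal) := by
  obtain ⟨n, w, P, hP, hp, hr⟩ := h
  calc affineCost S p ≤ ((∑ i, |w i| : ℝ) : EReal) := sInf_le ⟨n, w, P, hP, hp, rfl⟩
    _ ≤ r := EReal.coe_le_coe_iff.2 hr

end HasAffineModel

/-! ### Behaviors -/

section Behaviors

variable {X Y A B A' B' : Type*}

/-- The players sample independently: Alice from `α x`, Bob from `β y`. -/
def productBehavior (α : X → A → ℝ) (β : Y → B → ℝ) : Behavior X Y A B :=
  fun x y a b => α x a * β y b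

/-- All behaviors in which the players sample independently lie in `S`; this is what is needed of
`localSet` and `quantumSet` to correct the outcomes of a protocol that may abort. -/
def ContainsProducts [Fintype A] [Fintype B] (S : Set (Behavior X Y A B)) : Prop :=
  ∀ α β, (∀ x, α x ∈ stdSimplex ℝ A) → (∀ y, β y ∈ stdSimplex ℝ B) → productBehavior α β ∈ S

/-- The behavior of players who replace their outcomes `a`, `b` by `f x a`, `g y b`. -/
def postprocess [Fintype A] [Fintype B] [DecidableEq A'] [DecidableEq B'] (f : X → A → A')
    (g : Y → B → B') : Behavior X Y A B →ₗ[ℝ] Behavior X Y A' B' where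
  toFun p x y a' b' := ∑ a, ∑ b, if f x a = a' ∧ g y b = b' then p x y a b else 0
  map_add' p p' := by
    funext x y a' b'
    simp [← Finset.sum_add_distrib, ite_add_ite]
  map_smul' c p := by
    funext x y a' b'
    simp [Finset.mul_sum]

theorem postprocess_apply [Fintype A] [Fintype B] [DecidableEq A'] [DecidableEq B']
    (f : X → A → A') (g : Y → B → B') (p : Behavior X Y A B) (x : X) (y : Y) (a' : A') (b' : B') :
    postprocess f g p x y a' b' =
      ∑ a, ∑ b, if f x a = a' ∧ g y b = b' then p x y a b else 0 := rfl

/-- The part of a behavior in which neither player aborts, abortion being the outcome `none`. It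
is not normalized. -/
def accepted : Behavior X Y (Option A) (Option B) →ₗ[ℝ] Behavior X Y A B where
  toFun G x y a b := G x y (some a) (some b)
  map_add' _ _ := rfl
  map_smul' _ _ := rfl

@[simp]
theorem accepted_apply (G : Behavior X Y (Option A) (Option B)) (x : X) (y : Y) (a : A) (b : B) :
    accepted G x y a b = G x y (some a) (some b) := rfl

/-- The expectation of the product of the values `v a` and `w b` of the outcomes. -/
def correlation [Fintype A] [Fintype B] (v : A → ℝ) (w : B → ℝ) (p : Behavior X Y A B) :
    X → Y → ℝ :=
  fun x y => ∑ a, ∑ b, v a * w b * p x y a b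

theorem sum_ofCorrelation (C : X → Y → ℝ) (x : X) (y : Y) :
    ∑ a : ℤˣ, ∑ b : ℤˣ, ((a : ℤ) : ℝ) * ((b : ℤ) : ℝ) * ofCorrelation C x y a b = C x y := by
  rw [UnitsInt.univ, Finset.sum_pair (by decide), Finset.sum_pair (by decide),
    Finset.sum_pair (by decide)]
  simp only [ofCorrelation]
  push_cast
  ring

end Behaviors

/-! ### Postselection -/

section Postselection

variable {X Y A B : Type*} [Fintype A] [Fintype B]

theorem exists_mem_stdSimplex_eq_smul [Nonempty A] {v : A → ℝ} (hv : 0 ≤ v) :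
    ∃ w ∈ stdSimplex ℝ A, v = (∑ a, v a) • w := by
  classical
  rcases (Finset.sum_nonneg fun a _ => hv a).eq_or_lt' with h | h
  · refine ⟨_, single_mem_stdSimplex ℝ (Classical.arbitrary A), ?_⟩
    rw [h, zero_smul]
    funext a
    exact (Finset.sum_eq_zero_iff_of_nonneg fun a _ => hv a).1 h a (Finset.mem_univ a)
  · refine ⟨(∑ a, v a)⁻¹ • v, ⟨fun a => ?_, ?_⟩, ?_⟩
    · exact mul_nonneg (inv_nonneg.2 h.le) (hv a)
    · simp [← Finset.mul_sum, h.ne']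
    · rw [smul_inv_smul₀ h.ne']

theorem ContainsProducts.hasAffineModel [Nonempty A] [Nonempty B] {S : Set (Behavior X Y A B)}
    (hS : ContainsProducts S) {f : X → A → ℝ} {g : Y → B → ℝ} {s t : ℝ} (hf : ∀ x, 0 ≤ f x)
    (hg : ∀ y, 0 ≤ g y) (hfs : ∀ x, ∑ a, f x a = s) (hgt : ∀ y, ∑ b, g y b = t) :
    HasAffineModel S (productBehavior f g) |s * t| := by
  choose α hα hfα using fun x => exists_mem_stdSimplex_eq_smul (hf x)
  choose β hβ hgβ using fun y => exists_mem_stdSimplex_eq_smul (hg y)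
  convert HasAffineModel.smul_of_mem (hS α β hα hβ) (s * t) using 1
  funext x y a b
  simp only [productBehavior, Pi.smul_apply, smul_eq_mul]
  rw [hfα x, hgβ y, hfs, hgt, Pi.smul_apply, Pi.smul_apply, smul_eq_mul, smul_eq_mul]
  ring

variable [DecidableEq A] [DecidableEq B]

/-- Unnormalized behavior of players of whom at most one deviates from the default outcomes `a₀`,
`b₀`: with weight `rA x a` Alice outputs `a`, with weight `rB y b` Bob outputs `b`, and the total
weight is `N`. -/
def residualBehavior (a₀ : A) (b₀ : B) (rA : X → A → ℝ) (rB : Y → B → ℝ) (N : ℝ) :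
    Behavior X Y A B :=
  fun x y a b => (if b = b₀ then rA x a else 0) + (if a = a₀ then rB y b else 0) +
    if a = a₀ ∧ b = b₀ then N - ∑ a, rA x a - ∑ b, rB y b else 0

theorem ContainsProducts.hasAffineModel_residualBehavior [Nonempty X] [Nonempty Y]
    {S : Set (Behavior X Y A B)} (hS : ContainsProducts S) (a₀ : A) (b₀ : B) {rA : X → A → ℝ}
    {rB : Y → B → ℝ} {N : ℝ} (hA : ∀ x a, 0 ≤ rA x a) (hB : ∀ y b, 0 ≤ rB y b)
    (hN : ∀ x y, ∑ a, rA x a + ∑ b, rB y b ≤ N) :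
    HasAffineModel S (residualBehavior a₀ b₀ rA rB N) N := by
  have : Nonempty A := ⟨a₀⟩
  have : Nonempty B := ⟨b₀⟩
  -- Filled up with default outcomes, Alice's part has weight `s` and Bob's part weight `N - s`.
  set s := ⨆ x, ∑ a, rA x a
  have hs₀ : 0 ≤ s := Real.iSup_nonneg fun x => Finset.sum_nonneg fun a _ => hA x a
  have hAs : ∀ x, ∑ a, rA x a ≤ s :=
    le_ciSup ⟨N - ∑ b, rB (Classical.arbitrary Y) b, Set.forall_mem_range.2 fun x => by
      linarith [hN x (Classical.arbitrary Y)]⟩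
  have hBs : ∀ y, ∑ b, rB y b ≤ N - s := fun y => by
    have : s ≤ N - ∑ b, rB y b := ciSup_le fun x => by linarith [hN x y]
    linarith
  have hNs₀ : 0 ≤ N - s :=
    (Finset.sum_nonneg fun b _ => hB (Classical.arbitrary Y) b).trans (hBs _)
  have hAlice := hS.hasAffineModel (s := s) (t := 1)
    (f := fun x a => rA x a + if a = a₀ then s - ∑ a, rA x a else 0)
    (g := fun _ b => if b = b₀ then 1 else 0)
    (fun x a => add_nonneg (hA x a) (by split_ifs <;> linarith [hAs x]))
    (fun _ b => by dsimp; positivity)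
    (fun x => by simp [Finset.sum_add_distrib]) (fun _ => by simp)
  have hBob := hS.hasAffineModel (s := 1) (t := N - s)
    (f := fun _ a => if a = a₀ then 1 else 0)
    (g := fun y b => rB y b + if b = b₀ then N - s - ∑ b, rB y b else 0)
    (fun _ a => by dsimp; positivity)
    (fun y b => add_nonneg (hB y b) (by split_ifs <;> linarith [hBs y]))
    (fun _ => by simp) (fun y => by simp [Finset.sum_add_distrib])
  convert hAlice.add hBob using 1
  · funext x y a b
    simp only [residualBehavior, productBehavior, Pi.add_apply]
    by_cases ha : a = a₀ <;> by_cases hb : b = b₀ <;> simp [ha, hb]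
    ring
  · rw [mul_one, one_mul, abs_of_nonneg hs₀, abs_of_nonneg hNs₀]
    ring

/-- Since `p` and `G` are non-signaling, the probability that only Alice aborts does not depend on
her input, nor the probability that only Bob aborts on his: relabelling the abort outcomes changes
`accepted G` by a residual behavior. -/
theorem IsNonSignaling.exists_eq_smul_postprocess_sub_residualBehavior [Nonempty X] [Nonempty Y]
    {p : Behavior X Y A B} {G : Behavior X Y (Option A) (Option B)} {N : ℝ}
    (hp : IsNonSignaling p) (hG : IsNonSignaling G) (hN : 0 ≤ N) (hpG : p = N • accepted G)
    (a₀ : A) (b₀ : B) :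
    ∃ (rA : X → A → ℝ) (rB : Y → B → ℝ), (∀ x a, 0 ≤ rA x a) ∧ (∀ y b, 0 ≤ rB y b) ∧
      (∀ x y, ∑ a, rA x a + ∑ b, rB y b ≤ N - 1) ∧
      p = N • postprocess (fun _ o => o.getD a₀) (fun _ o => o.getD b₀) G -
        residualBehavior a₀ b₀ rA rB (N - 1) := by
  let x₀ := Classical.arbitrary X
  let y₀ := Classical.arbitrary Y
  have hpG' : ∀ x y a b, p x y a b = N * G x y (some a) (some b) := fun x y a b => by simp [hpG]
  have hA : ∀ x y a, N * G x y (some a) none = N * G x y₀ (some a) none := fun x y a => by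
    have hmarg := congrArg (N * ·) (hG.marginal_alice (some a) x y y₀)
    have hmarg' := hp.marginal_alice a x y y₀
    simp only [Fintype.sum_option, mul_add, Finset.mul_sum, ← hpG'] at hmarg
    linarith
  have hB : ∀ x y b, N * G x y none (some b) = N * G x₀ y none (some b) := fun x y b => by
    have hmarg := congrArg (N * ·) (hG.marginal_bob (some b) x x₀ y)
    have hmarg' := hp.marginal_bob b x x₀ y
    simp only [Fintype.sum_option, mul_add, Finset.mul_sum, ← hpG'] at hmarg
    linarith
  have hnone : ∀ x y, N * G x y none none =
      N - 1 - ∑ a, N * G x y₀ (some a) none - ∑ b, N * G x₀ y none (some b) := fun x y => by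
    have hsum := congrArg (N * ·) (hG.sum_eq_one x y)
    have hsum' := hp.sum_eq_one x y
    simp only [Fintype.sum_option, mul_add, Finset.mul_sum, Finset.sum_add_distrib, ← hpG', hsum',
      hA x y, hB x y] at hsum
    linarith
  refine ⟨fun x a => N * G x y₀ (some a) none, fun y b => N * G x₀ y none (some b),
    fun x a => mul_nonneg hN (hG.nonneg _ _ _ _), fun y b => mul_nonneg hN (hG.nonneg _ _ _ _),
    fun x y => by linarith [mul_nonneg hN (hG.nonneg x y none none), hnone x y], ?_⟩
  funext x y a b
  simp only [residualBehavior, Pi.sub_apply, Pi.smul_apply, smul_eq_mul, postprocess_apply,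
    Fintype.sum_option, Option.getD_none, Option.getD_some, Finset.sum_add_distrib, ite_and,
    mul_add, Finset.mul_sum, mul_ite, mul_zero, hA x y, hB x y, hnone x y, ← hpG']
  simp [eq_comm]
  ring

theorem IsNonSignaling.hasAffineModel_of_eq_smul_accepted {S : Set (Behavior X Y A B)}
    (hS : ContainsProducts S) {p : Behavior X Y A B} {G : Behavior X Y (Option A) (Option B)}
    {N : ℝ} (hp : IsNonSignaling p) (hG : IsNonSignaling G) (hN : 1 ≤ N)
    (hpG : p = N • accepted G)
    (hGS : ∀ a₀ b₀, postprocess (fun _ o => o.getD a₀) (fun _ o => o.getD b₀) G ∈ S) :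
    HasAffineModel S p (2 * N - 1) := by
  by_cases hXY : Nonempty X ∧ Nonempty Y ∧ Nonempty A ∧ Nonempty B
  · obtain ⟨_, _, ⟨a₀⟩, ⟨b₀⟩⟩ := hXY
    obtain ⟨rA, rB, hA, hB, hr, hp'⟩ := hp.exists_eq_smul_postprocess_sub_residualBehavior hG
      (zero_le_one.trans hN) hpG a₀ b₀
    have hmain := HasAffineModel.smul_of_mem (hGS a₀ b₀) N
    rw [abs_of_nonneg (zero_le_one.trans hN)] at hmain
    rw [hp', sub_eq_add_neg]
    exact (hmain.add (hS.hasAffineModel_residualBehavior a₀ b₀ hA hB hr).neg).mono (by linarith)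
  · have : p = 0 := by
      funext x y a b
      exact absurd ⟨⟨x⟩, ⟨y⟩, ⟨a⟩, ⟨b⟩⟩ hXY
    rw [this]
    exact HasAffineModel.zero.mono (by linarith)

theorem hasAffineModel_ofCorrelation {X Y : Type*} {S : Set (Behavior X Y ℤˣ ℤˣ)}
    {C : X → Y → ℝ} {N : ℝ} (hN : 1 ≤ N) (h : ofCorrelation (N⁻¹ • C) ∈ S)
    (h' : ofCorrelation (-N⁻¹ • C) ∈ S) : HasAffineModel S (ofCorrelation C) N := by
  convert (HasAffineModel.smul_of_mem h ((N + 1) / 2)).add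
    (HasAffineModel.smul_of_mem h' (-((N - 1) / 2))) using 1
  · funext x y a b
    simp only [ofCorrelation, Pi.add_apply, Pi.smul_apply, smul_eq_mul]
    field_simp
    ring
  · rw [abs_neg, abs_of_nonneg (by linarith), abs_of_nonneg (by linarith)]
    ring

end Postselection

/-! ### Local behaviors -/

section Local

theorem mem_of_mem_convexHull_of_affine {V W : Type*} [AddCommGroup V] [Module ℝ V]
    [AddCommGroup W] [Module ℝ W] {s : Set V} {S : Set W} (hS : Convex ℝ S) {Φ : V → W}
    (hΦ : ∀ p p' c d, c + d = (1 : ℝ) → Φ (c • p + d • p') = c • Φ p + d • Φ p')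
    (h : ∀ p ∈ s, Φ p ∈ S) {p : V} (hp : p ∈ convexHull ℝ s) : Φ p ∈ S := by
  refine convexHull_min (t := Φ ⁻¹' S) h (fun p hp p' hp' c d hc hd hcd => ?_) hp
  rw [Set.mem_preimage, hΦ p p' c d hcd]
  exact hS hp hp' hc hd hcd

variable {X Y A B A' B' : Type*} [DecidableEq A] [DecidableEq B]

theorem convex_localSet : Convex ℝ (localSet X Y A B) := convex_convexHull ℝ _

theorem localDeterministic_mem_localSet (f : X → A) (g : Y → B) :
    localDeterministic f g ∈ localSet X Y A B :=
  subset_convexHull ℝ _ ⟨f, g, rfl⟩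

theorem isCompact_localSet [Finite X] [Finite Y] [Finite A] [Finite B] :
    IsCompact (localSet X Y A B) := by
  have : {p : Behavior X Y A B | ∃ f g, p = localDeterministic f g} =
      Set.range fun i : (X → A) × (Y → B) => localDeterministic i.1 i.2 := by
    ext p
    simp [eq_comm]
  rw [localSet, this]
  exact (Set.finite_range _).isCompact_convexHull ℝ

variable [Fintype A] [Fintype B]

theorem mem_convexHull_range_of_forall_mem_stdSimplex [Finite X] {α : X → A → ℝ}
    (hα : ∀ x, α x ∈ stdSimplex ℝ A) :
    α ∈ convexHull ℝ (Set.range fun (f : X → A) x a => if f x = a then (1 : ℝ) else 0) := by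
  have hmem : α ∈ convexHull ℝ
      (Set.univ.pi fun _ : X => Set.range fun a a' : A => if a = a' then (1 : ℝ) else 0) :=
    mem_convexHull_pi fun x _ => by rw [convexHull_basis_eq_stdSimplex]; exact hα x
  refine convexHull_mono (fun v hv => ?_) hmem
  choose f hf using fun x => hv x (Set.mem_univ x)
  exact ⟨f, funext hf⟩

theorem containsProducts_localSet [Finite X] [Finite Y] :
    ContainsProducts (localSet X Y A B) := by
  intro α β hα hβ
  refine mem_of_mem_convexHull_of_affine (Φ := (productBehavior · β)) convex_localSet ?_ ?_
    (mem_convexHull_range_of_forall_mem_stdSimplex hα)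
  · intro α₁ α₂ c d _
    funext x y a b
    simp only [productBehavior, Pi.add_apply, Pi.smul_apply, smul_eq_mul]
    ring
  rintro _ ⟨f, rfl⟩
  refine mem_of_mem_convexHull_of_affine (Φ := productBehavior _) convex_localSet ?_ ?_
    (mem_convexHull_range_of_forall_mem_stdSimplex hβ)
  · intro β₁ β₂ c d _
    funext x y a b
    simp only [productBehavior, Pi.add_apply, Pi.smul_apply, smul_eq_mul]
    ring
  rintro _ ⟨g, rfl⟩
  convert localDeterministic_mem_localSet f g using 1
  funext x y a b
  simp [productBehavior, localDeterministic, ← ite_and, eq_comm, and_comm]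

theorem isNonSignaling_of_mem_localSet {p : Behavior X Y A B} (hp : p ∈ localSet X Y A B) :
    IsNonSignaling p := by
  refine convexHull_min (t := {p | IsNonSignaling p}) ?_ ?_ hp
  · rintro _ ⟨f, g, rfl⟩
    exact {
      nonneg := fun x y a b => by unfold localDeterministic; positivity
      sum_eq_one := fun x y => by simp [localDeterministic, ite_and]
      marginal_alice := fun a x y y' => by simp [localDeterministic, ite_and]
      marginal_bob := fun b x x' y => by simp [localDeterministic, ite_and] }
  · intro p hp p' hp' c d hc hd hcd
    exact {
      nonneg := fun x y a b => add_nonneg (mul_nonneg hc (hp.nonneg x y a b))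
        (mul_nonneg hd (hp'.nonneg x y a b))
      sum_eq_one := fun x y => by
        simp [Finset.sum_add_distrib, ← Finset.mul_sum, hp.sum_eq_one, hp'.sum_eq_one, hcd]
      marginal_alice := fun a x y y' => by
        simp [Finset.sum_add_distrib, ← Finset.mul_sum, hp.marginal_alice a x y y',
          hp'.marginal_alice a x y y']
      marginal_bob := fun b x x' y => by
        simp [Finset.sum_add_distrib, ← Finset.mul_sum, hp.marginal_bob b x x' y,
          hp'.marginal_bob b x x' y] }

variable [DecidableEq A'] [DecidableEq B']

theorem postprocess_localDeterministic (f : X → A → A') (g : Y → B → B') (l : X → A) (m : Y → B) :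
    postprocess f g (localDeterministic l m) =
      localDeterministic (fun x => f x (l x)) fun y => g y (m y) := by
  funext x y a' b'
  have hcomm : ∀ a b, (if f x a = a' ∧ g y b = b' then localDeterministic l m x y a b else 0) =
      if a = l x then if b = m y then (if a' = f x a ∧ b' = g y b then (1 : ℝ) else 0) else 0
        else 0 := fun a b => by
    simp only [localDeterministic]
    split_ifs <;> simp_all
  simp only [postprocess_apply, hcomm]
  simp [localDeterministic]

theorem postprocess_mem_localSet {p : Behavior X Y A B} (hp : p ∈ localSet X Y A B)
    (f : X → A → A') (g : Y → B → B') : postprocess f g p ∈ localSet X Y A' B' := by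
  refine mem_of_mem_convexHull_of_affine convex_localSet (fun p p' c d _ => by simp) ?_ hp
  rintro _ ⟨l, m, rfl⟩
  rw [postprocess_localDeterministic]
  exact localDeterministic_mem_localSet _ _

theorem sign_mem_stdSimplex {r : ℝ} (hr : |r| ≤ 1) :
    (fun a : ℤˣ => (1 + ((a : ℤ) : ℝ) * r) / 2) ∈ stdSimplex ℝ ℤˣ := by
  refine ⟨fun a => ?_, ?_⟩
  · have := abs_le.1 hr
    rcases Int.units_eq_one_or a with rfl | rfl <;> push_cast <;> linarith
  · rw [UnitsInt.univ, Finset.sum_pair (by decide)]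
    push_cast
    ring

theorem ofCorrelation_mul_mem_localSet [Finite X] [Finite Y] {F : X → ℝ} {G : Y → ℝ}
    (hF : ∀ x, |F x| ≤ 1) (hG : ∀ y, |G y| ≤ 1) :
    ofCorrelation (fun x y => F x * G y) ∈ localSet X Y ℤˣ ℤˣ := by
  have h₁ := containsProducts_localSet _ _ (fun x => sign_mem_stdSimplex (hF x))
    fun y => sign_mem_stdSimplex (hG y)
  have h₂ := containsProducts_localSet _ _
    (fun x => sign_mem_stdSimplex ((abs_neg _).trans_le (hF x)))
    fun y => sign_mem_stdSimplex ((abs_neg _).trans_le (hG y))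
  convert convex_localSet h₁ h₂ (a := 1 / 2) (b := 1 / 2) (by norm_num) (by norm_num)
    (by norm_num) using 1
  funext x y a b
  simp only [ofCorrelation, productBehavior, Pi.add_apply, Pi.smul_apply, smul_eq_mul]
  ring

theorem ofCorrelation_correlation_mem_localSet [Finite X] [Finite Y] {v : A → ℝ} {w : B → ℝ}
    (hv : ∀ a, |v a| ≤ 1) (hw : ∀ b, |w b| ≤ 1) {p : Behavior X Y A B}
    (hp : p ∈ localSet X Y A B) :
    ofCorrelation (correlation v w p) ∈ localSet X Y ℤˣ ℤˣ := by
  refine mem_of_mem_convexHull_of_affine (Φ := fun p => ofCorrelation (correlation v w p))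
    convex_localSet ?_ ?_ hp
  · intro p p' c d hcd
    funext x y a b
    simp only [ofCorrelation, correlation, Pi.add_apply, Pi.smul_apply, smul_eq_mul, mul_add,
      Finset.sum_add_distrib, mul_left_comm _ c, mul_left_comm _ d, ← Finset.mul_sum]
    linear_combination (-(1 : ℝ) / 4) * hcd
  · rintro _ ⟨f, g, rfl⟩
    convert ofCorrelation_mul_mem_localSet (fun x => hv (f x)) fun y => hw (g y) using 1
    congr 1
    funext x y
    simp [correlation, localDeterministic, ite_and]

end Local

/-! ### Classical protocols -/

section Classical

variable {X Y A B : Type*} [DecidableEq A] [DecidableEq B]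

/-- The behavior of a deterministic protocol. -/
def ProtocolTree.behavior (T : ProtocolTree X Y A B) : Behavior X Y A B :=
  fun x y a b => if T.run x y = (a, b) then 1 else 0

theorem accepted_postprocess_ite [Fintype A] [Fintype B] (P : X → Prop) (Q : Y → Prop)
    [DecidablePred P] [DecidablePred Q] (G : Behavior X Y (Option A) (Option B)) (x : X) (y : Y)
    (a : A) (b : B) :
    accepted (postprocess (fun x o => if P x then o else none)
      (fun y o => if Q y then o else none) G) x y a b =
      if P x ∧ Q y then accepted G x y a b else 0 := by
  by_cases hP : P x <;> by_cases hQ : Q y <;> simp [postprocess_apply, hP, hQ, ite_and]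

/-- Without communication the players can run the continuation of a protocol after a bit `s x y`
that only one of them knows: they guess the bit, and the one who knows it aborts if the guess `c`
is wrong. The predicates `P c` and `Q c` tell who does not abort. -/
theorem exists_mem_localSet_of_guess [Finite A] [Finite B] {D : Bool → Behavior X Y A B} {N : ℝ}
    (hD : ∀ c, ∃ G ∈ localSet X Y (Option A) (Option B), D c = N • accepted G)
    (s : X → Y → Bool) (P : Bool → X → Prop) (Q : Bool → Y → Prop)
    (hPQ : ∀ c x y, P c x ∧ Q c y ↔ s x y = c) :
    ∃ G ∈ localSet X Y (Option A) (Option B),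
      (fun x y => D (s x y) x y) = (N * 2) • accepted G := by
  classical
  have := Fintype.ofFinite A
  have := Fintype.ofFinite B
  choose G hG hDG using hD
  let G' c := postprocess (fun x o => if P c x then o else none)
    (fun y o => if Q c y then o else none) (G c)
  refine ⟨(1 / 2 : ℝ) • G' false + (1 / 2 : ℝ) • G' true, convex_localSet
    (postprocess_mem_localSet (hG _) _ _) (postprocess_mem_localSet (hG _) _ _) (by norm_num)
    (by norm_num) (by norm_num), ?_⟩
  funext x y a b
  simp only [map_add, map_smul, Pi.add_apply, Pi.smul_apply, smul_eq_mul, G',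
    accepted_postprocess_ite, hPQ, hDG]
  cases s x y <;> simp [mul_assoc]

theorem ProtocolTree.exists_behavior_eq_smul_accepted [Finite A] [Finite B]
    (T : ProtocolTree X Y A B) {t : ℕ} (hT : T.depth ≤ t) :
    ∃ G ∈ localSet X Y (Option A) (Option B), T.behavior = (2 ^ t : ℝ) • accepted G := by
  induction T generalizing t with
  | output f g =>
    -- A protocol that ends early accepts too often; it aborts with the complementary probability.
    have hpow : (2 ^ t : ℝ)⁻¹ ≤ 1 := inv_le_one_of_one_le₀ (one_le_pow₀ one_le_two)
    refine ⟨_, convex_localSet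
      (localDeterministic_mem_localSet (fun x => some (f x)) fun y => some (g y))
      (localDeterministic_mem_localSet (fun _ => none) fun _ => none)
      (inv_nonneg.2 (by positivity)) (sub_nonneg.2 hpow) (add_sub_cancel _ _), ?_⟩
    funext x y a b
    simp [behavior, run, localDeterministic, Prod.ext_iff, eq_comm]
  | alice m next ih =>
    obtain _ | t := t
    · simp [depth] at hT
    have hd : ∀ c, (next c).depth ≤ t := by
      simp only [depth, add_le_add_iff_right, max_le_iff] at hT
      exact Bool.forall_bool.2 hT
    exact exists_mem_localSet_of_guess (fun c => ih c (hd c)) (fun x _ => m x)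
      (fun c x => m x = c) (fun _ _ => True) (by simp)
  | bob m next ih =>
    obtain _ | t := t
    · simp [depth] at hT
    have hd : ∀ c, (next c).depth ≤ t := by
      simp only [depth, add_le_add_iff_right, max_le_iff] at hT
      exact Bool.forall_bool.2 hT
    exact exists_mem_localSet_of_guess (fun c => ih c (hd c)) (fun _ y => m y)
      (fun _ _ => True) (fun c y => m y = c) (by simp)

/-- The numerical value of an outcome `±1`; an aborting player is given the value `0`. -/
def signOrZero : Option ℤˣ → ℝ := fun o => o.elim 0 fun a => ((a : ℤ) : ℝ)

theorem abs_signOrZero_le_one : ∀ o, |signOrZero o| ≤ 1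
  | none => by simp [signOrZero]
  | some a => by rcases Int.units_eq_one_or a with rfl | rfl <;> simp [signOrZero]

theorem correlation_signOrZero (G : Behavior X Y (Option ℤˣ) (Option ℤˣ)) (x : X) (y : Y) :
    correlation signOrZero signOrZero G x y =
      ∑ a : ℤˣ, ∑ b : ℤˣ, ((a : ℤ) : ℝ) * ((b : ℤ) : ℝ) * accepted G x y a b := by
  simp only [correlation, Fintype.sum_option, signOrZero, Option.elim, zero_mul, mul_zero,
    Finset.sum_const_zero, zero_add, accepted_apply]

theorem smul_correlation_signOrZero {C : X → Y → ℝ} {N : ℝ}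
    {G : Behavior X Y (Option ℤˣ) (Option ℤˣ)} (h : ofCorrelation C = N • accepted G) :
    N • correlation signOrZero signOrZero G = C := by
  funext x y
  rw [← sum_ofCorrelation C x y, h]
  simp only [Pi.smul_apply, smul_eq_mul, correlation_signOrZero, Finset.mul_sum, mul_left_comm N]

variable [Finite X] [Finite Y]

/-- The shared randomness averages points of a compact convex set. -/
theorem SimulableWithBits.exists_eq_smul_accepted [Finite A] [Finite B]
    {p : Behavior X Y A B} {t : ℕ} (h : SimulableWithBits p t) :
    ∃ G ∈ localSet X Y (Option A) (Option B), p = (2 ^ t : ℝ) • accepted G := by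
  obtain ⟨Ω, _, μ, _, T, hT, hp⟩ := h
  have := Fintype.ofFinite X
  have := Fintype.ofFinite Y
  have := Fintype.ofFinite A
  have := Fintype.ofFinite B
  let Φ : Behavior X Y (Option A) (Option B) →ₗ[ℝ] Behavior X Y A B := (2 ^ t : ℝ) • accepted
  let K := Φ '' localSet X Y (Option A) (Option B)
  have hconv : Convex ℝ K := convex_localSet.linear_image _
  have hclosed : IsClosed K :=
    (isCompact_localSet.image Φ.continuous_of_finiteDimensional).isClosed
  have hmem : ∀ ω, (T ω).behavior ∈ K := fun ω =>
    let ⟨G, hG, hTG⟩ := (T ω).exists_behavior_eq_smul_accepted (hT ω)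
    ⟨G, hG, hTG.symm⟩
  have hcoord : ∀ x y a b, (fun ω => (T ω).behavior x y a b) =
      {ω | (T ω).run x y = (a, b)}.indicator 1 := fun x y a b => by
    funext ω
    simp [ProtocolTree.behavior, Set.indicator_apply]
  have hint : ∀ x y a b, Integrable (fun ω => (T ω).behavior x y a b) μ := fun x y a b => by
    rw [hcoord]
    exact (integrable_const 1).indicator (hp x y a b).1
  have hint₄ := fun x y a => Integrable.of_eval (hint x y a)
  have hint₃ := fun x y => Integrable.of_eval (hint₄ x y)
  have hint₂ := fun x => Integrable.of_eval (hint₃ x)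
  have hpK : p = ∫ ω, (T ω).behavior ∂μ := by
    funext x y a b
    rw [eval_integral hint₂, eval_integral (hint₃ x), eval_integral (hint₄ x y),
      eval_integral (hint x y a), hcoord, integral_indicator_one (hp x y a b).1]
    exact (hp x y a b).2
  have hpmem : p ∈ K := hpK ▸
    hconv.integral_mem hclosed (Filter.Eventually.of_forall hmem) (Integrable.of_eval hint₂)
  obtain ⟨G, hG, hpG⟩ := hpmem
  exact ⟨G, hG, hpG.symm⟩

theorem SimulableWithBits.hasAffineModel [Fintype A] [Fintype B] {p : Behavior X Y A B}
    (hp : IsNonSignaling p) {t : ℕ} (h : SimulableWithBits p t) :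
    HasAffineModel (localSet X Y A B) p (2 ^ (t + 1) - 1) := by
  obtain ⟨G, hG, hpG⟩ := h.exists_eq_smul_accepted
  rw [pow_succ']
  exact hp.hasAffineModel_of_eq_smul_accepted containsProducts_localSet
    (isNonSignaling_of_mem_localSet hG) (one_le_pow₀ one_le_two) hpG
    fun a₀ b₀ => postprocess_mem_localSet hG _ _

theorem SimulableWithBits.hasAffineModel_ofCorrelation {C : X → Y → ℝ} {t : ℕ}
    (h : SimulableWithBits (ofCorrelation C) t) :
    HasAffineModel (localSet X Y ℤˣ ℤˣ) (ofCorrelation C) (2 ^ t) := by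
  obtain ⟨G, hG, hCG⟩ := h.exists_eq_smul_accepted
  have hpow : (2 ^ t : ℝ) ≠ 0 := by positivity
  have hC : ((2 ^ t : ℝ)⁻¹) • C = correlation signOrZero signOrZero G := by
    rw [← smul_correlation_signOrZero hCG, inv_smul_smul₀ hpow]
  have hC' : (-(2 ^ t : ℝ)⁻¹) • C = correlation (-signOrZero) signOrZero G := by
    rw [neg_smul, hC]
    funext x y
    simp only [correlation, Pi.neg_apply, neg_mul, Finset.sum_neg_distrib]
  refine _root_.hasAffineModel_ofCorrelation (one_le_pow₀ one_le_two) ?_ ?_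
  · rw [hC]
    exact ofCorrelation_correlation_mem_localSet abs_signOrZero_le_one abs_signOrZero_le_one hG
  · rw [hC']
    exact ofCorrelation_correlation_mem_localSet
      (fun o => (abs_neg _).trans_le (abs_signOrZero_le_one o)) abs_signOrZero_le_one hG

end Classical

/-! ### Block operators -/

section BlockOperators

/-- The direct sum of copies of `H` indexed by `ι`. -/
abbrev HilbertPower (ι H : Type*) : Type _ := PiLp 2 fun _ : ι => H

variable {ι H : Type*} [Fintype ι] [NormedAddCommGroup H] [InnerProductSpace ℂ H]

/-- The operator on a direct sum of copies of `H` with a given matrix of blocks. -/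
def blockMap (M : Matrix ι ι (H →L[ℂ] H)) : HilbertPower ι H →L[ℂ] HilbertPower ι H :=
  ((PiLp.continuousLinearEquiv 2 ℂ fun _ : ι => H).symm : (ι → H) →L[ℂ] HilbertPower ι H) ∘L
    ContinuousLinearMap.pi fun i => ∑ j, M i j ∘L PiLp.proj 2 (fun _ : ι => H) j

@[simp]
theorem blockMap_apply (M : Matrix ι ι (H →L[ℂ] H)) (v : HilbertPower ι H) (i : ι) :
    blockMap M v i = ∑ j, M i j (v j) := by
  simp [blockMap]

/-- The isometry `v ↦ v ⊗ c` for a unit vector `c`. -/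
def tensorIsometry (c : ι → ℂ) (hc : ∑ i, ‖c i‖ ^ 2 = 1) : H →ₗᵢ[ℂ] HilbertPower ι H :=
  LinearMap.isometryOfInner
    { toFun := fun v => WithLp.toLp 2 fun i => c i • v
      map_add' := fun v w => by
        ext i
        simp
      map_smul' := fun a v => by
        ext i
        exact smul_comm _ _ _ } fun v w => by
    have h : ∀ i, c i * (starRingEnd ℂ) (c i) = ((‖c i‖ ^ 2 : ℝ) : ℂ) := fun i => by
      rw [RCLike.mul_conj]
      simp
    simp only [PiLp.inner_apply, LinearMap.coe_mk, AddHom.coe_mk, inner_smul_left,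
      inner_smul_right, ← mul_assoc, h]
    rw [← Finset.sum_mul, ← Complex.ofReal_sum, hc]
    simp

@[simp]
theorem tensorIsometry_apply (c : ι → ℂ) (hc : ∑ i, ‖c i‖ ^ 2 = 1) (v : H) (i : ι) :
    tensorIsometry c hc v i = c i • v := rfl

variable [DecidableEq ι]

/-- The inclusion of a summand. -/
def blockInclusion (i : ι) : H →ₗᵢ[ℂ] HilbertPower ι H :=
  tensorIsometry (Pi.single i 1) (by simp [Pi.single_apply, apply_ite, ite_pow])

theorem blockInclusion_apply (i : ι) (v : H) (j : ι) :
    blockInclusion i v j = if j = i then v else 0 := by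
  simp [blockInclusion, Pi.single_apply]

variable [CompleteSpace H]

variable (ι H) in
/-- Matrices of operators act on a direct sum of copies of `H`. -/
def blockOp : Matrix ι ι (H →L[ℂ] H) →⋆ₐ[ℂ] (HilbertPower ι H →L[ℂ] HilbertPower ι H) where
  toFun := blockMap
  map_one' := by
    ext v i
    simp [Matrix.one_apply, apply_ite, ite_apply]
  map_mul' M N := by
    ext v i
    simp only [blockMap_apply, Matrix.mul_apply, sum_apply, map_sum,
      ContinuousLinearMap.mul_def, ContinuousLinearMap.comp_apply]
    rw [Finset.sum_comm]
  map_zero' := by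
    ext v i
    simp
  map_add' M N := by
    ext v i
    simp [Finset.sum_add_distrib]
  commutes' c := by
    ext v i
    rw [blockMap_apply, Finset.sum_eq_single i]
    · simp [Matrix.algebraMap_matrix_apply, Algebra.algebraMap_eq_smul_one]
    · intro j _ hj
      simp [Matrix.algebraMap_matrix_apply, hj.symm]
    · simp
  map_star' M := by
    rw [ContinuousLinearMap.star_eq_adjoint, ContinuousLinearMap.eq_adjoint_iff]
    intro v w
    simp only [PiLp.inner_apply, blockMap_apply, Matrix.star_apply, sum_inner, inner_sum,
      ContinuousLinearMap.star_eq_adjoint, ContinuousLinearMap.adjoint_inner_left]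
    exact Finset.sum_comm

theorem blockOp_apply (M : Matrix ι ι (H →L[ℂ] H)) (v : HilbertPower ι H) (i : ι) :
    blockOp ι H M v i = ∑ j, M i j (v j) := blockMap_apply M v i

variable (ι H) in
/-- The diagonal action of the operators on `H`. -/
def amplify : (H →L[ℂ] H) →⋆ₐ[ℂ] (HilbertPower ι H →L[ℂ] HilbertPower ι H) :=
  (blockOp ι H).comp
    { Matrix.scalarAlgHom ι ℂ with
      map_star' := fun T => by
        simp [Matrix.star_eq_conjTranspose, Matrix.scalar_apply, Matrix.diagonal_conjTranspose] }

theorem amplify_eq (T : H →L[ℂ] H) : amplify ι H T = blockOp ι H (Matrix.diagonal fun _ => T) := rfl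

theorem amplify_apply (T : H →L[ℂ] H) (v : HilbertPower ι H) (i : ι) :
    amplify ι H T v i = T (v i) := by
  rw [amplify_eq, blockOp_apply, Finset.sum_eq_single i]
  · simp
  · intro j _ hj
    simp [Matrix.diagonal_apply_ne' _ hj]
  · simp

theorem amplify_blockInclusion (T : H →L[ℂ] H) (i : ι) (v : H) :
    amplify ι H T (blockInclusion i v) = blockInclusion i (T v) := by
  ext j
  rw [amplify_apply, blockInclusion_apply, blockInclusion_apply]
  split_ifs <;> simp

theorem commute_amplify_blockOp {T : H →L[ℂ] H} {M : Matrix ι ι (H →L[ℂ] H)}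
    (h : ∀ i j, Commute T (M i j)) : Commute (amplify ι H T) (blockOp ι H M) := by
  rw [amplify_eq]
  refine Commute.map ?_ (blockOp ι H)
  ext i j : 1
  rw [Matrix.diagonal_mul, Matrix.mul_diagonal]
  exact h i j

theorem inner_blockInclusion_blockOp (M : Matrix ι ι (H →L[ℂ] H)) (i : ι) (v w : H) :
    inner ℂ (blockInclusion i v) (blockOp ι H M (blockInclusion i w)) = inner ℂ v (M i i w) := by
  rw [PiLp.inner_apply, Finset.sum_eq_single i]
  · rw [blockOp_apply, Finset.sum_eq_single i]
    · simp [blockInclusion_apply]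
    · intro j _ hj
      simp [blockInclusion_apply, hj]
    · simp
  · intro j _ hj
    simp [blockInclusion_apply, hj]
  · simp

end BlockOperators

/-! ### Dilation of measurements -/

section Dilation

variable {ι R : Type*} [DecidableEq ι] [Ring R]

/-- The self-adjoint unitary that completes the column `s`, with `∑ sᵢ² = 1`, preceded by a zero
entry. -/
def dilationUnitary (s : ι → R) : Matrix (Unit ⊕ ι) (Unit ⊕ ι) R :=
  Matrix.fromBlocks 0 (Matrix.of fun _ j => s j) (Matrix.of fun i _ => s i)
    (1 - Matrix.of fun i j => s i * s j)

theorem star_dilationUnitary [StarRing R] {s : ι → R} (hs : ∀ i, star (s i) = s i) :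
    star (dilationUnitary s) = dilationUnitary s := by
  rw [dilationUnitary, Matrix.star_eq_conjTranspose, Matrix.fromBlocks_conjTranspose]
  congr 1
  · simp
  · ext i j; simp [hs]
  · ext i j; simp [hs]
  · ext i j
    rw [Matrix.conjTranspose_sub, Matrix.conjTranspose_one]
    simp [hs]

theorem dilationUnitary_mul_self [Fintype ι] {s : ι → R} (hs : ∑ i, s i * s i = 1) :
    dilationUnitary s * dilationUnitary s = 1 := by
  have h₁ : (Matrix.of fun (_ : Unit) j => s j) * (Matrix.of fun i (_ : Unit) => s i) = 1 := by
    ext i j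
    simp [Matrix.mul_apply, hs]
  have h₂ : (Matrix.of fun i j => s i * s j) =
      (Matrix.of fun i (_ : Unit) => s i) * (Matrix.of fun (_ : Unit) j => s j) := by
    ext i j
    simp [Matrix.mul_apply]
  rw [dilationUnitary, Matrix.fromBlocks_multiply, h₂, ← Matrix.fromBlocks_one]
  generalize (Matrix.of fun (_ : Unit) j => s j) = U at *
  generalize (Matrix.of fun i (_ : Unit) => s i) = V at *
  congr 1
  · simp [h₁]
  · simp [Matrix.mul_sub, ← Matrix.mul_assoc, h₁]
  · simp [Matrix.sub_mul, Matrix.mul_assoc, h₁]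
  · have : V * U * (V * U) = V * U := by
      rw [Matrix.mul_assoc, ← Matrix.mul_assoc U, h₁, Matrix.one_mul]
    simp [mul_sub, sub_mul, this]

theorem commute_dilationUnitary {s : ι → R} {T : R} (h : ∀ i, Commute T (s i))
    (i j : Unit ⊕ ι) : Commute T (dilationUnitary s i j) := by
  rcases i with i | i <;> rcases j with j | j
  · simp [dilationUnitary]
  · simpa [dilationUnitary] using h j
  · simpa [dilationUnitary] using h i
  · simp only [dilationUnitary, Matrix.fromBlocks_apply₂₂, Matrix.sub_apply, Matrix.of_apply]
    refine Commute.sub_right ?_ ((h i).mul_right (h j))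
    rw [Matrix.one_apply]
    split_ifs
    exacts [Commute.one_right T, Commute.zero_right T]

end Dilation

/-- A measurement given by positive operators that add up to the identity (POVM). -/
structure IsPositiveMeasurement {A H : Type*} [Fintype A] [NormedAddCommGroup H]
    [InnerProductSpace ℂ H] [CompleteSpace H] (α : A → H →L[ℂ] H) : Prop where
  nonneg : ∀ a, 0 ≤ α a
  sum_eq_one : ∑ a, α a = 1

section Measurements

variable {A B H K : Type*} [Fintype A] [Fintype B] [NormedAddCommGroup H] [InnerProductSpace ℂ H]
  [CompleteSpace H] [NormedAddCommGroup K] [InnerProductSpace ℂ K] [CompleteSpace K]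
  {α E : A → H →L[ℂ] H}

theorem IsProjectiveMeasurement.isPositiveMeasurement (hE : IsProjectiveMeasurement E) :
    IsPositiveMeasurement E where
  nonneg a := by
    have h := star_mul_self_nonneg (E a)
    rwa [(hE.selfAdjoint a).star_eq, hE.idem] at h
  sum_eq_one := hE.sum_eq_one

theorem IsProjectiveMeasurement.map (hE : IsProjectiveMeasurement E)
    (π : (H →L[ℂ] H) →⋆ₐ[ℂ] (K →L[ℂ] K)) : IsProjectiveMeasurement fun a => π (E a) where
  selfAdjoint a := (hE.selfAdjoint a).map π
  idem a := by rw [← map_mul, hE.idem]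
  orthogonal a a' h := by rw [← map_mul, hE.orthogonal a a' h, map_zero]
  sum_eq_one := by rw [← map_sum, hE.sum_eq_one, map_one]

theorem IsProjectiveMeasurement.conj (hE : IsProjectiveMeasurement E) {U : H →L[ℂ] H}
    (hU : U ∈ unitary (H →L[ℂ] H)) : IsProjectiveMeasurement fun a => star U * E a * U := by
  simpa using hE.map (Unitary.conjStarAlgAut ℂ _ (star (⟨U, hU⟩ : unitary (H →L[ℂ] H))) :
    (H →L[ℂ] H) →⋆ₐ[ℂ] (H →L[ℂ] H))

theorem IsPositiveMeasurement.map (hα : IsPositiveMeasurement α)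
    (π : (H →L[ℂ] H) →⋆ₐ[ℂ] (K →L[ℂ] K)) : IsPositiveMeasurement fun a => π (α a) where
  nonneg a := map_nonneg π (hα.nonneg a)
  sum_eq_one := by rw [← map_sum, hα.sum_eq_one, map_one]

theorem IsPositiveMeasurement.nonempty_outcome [Nontrivial H] (hα : IsPositiveMeasurement α) :
    Nonempty A := by
  by_contra h
  rw [not_nonempty_iff] at h
  simpa using hα.sum_eq_one

end Measurements

section Naimark

variable {A ι H : Type*} [DecidableEq A] [Fintype ι] [DecidableEq ι] [NormedAddCommGroup H]
  [InnerProductSpace ℂ H] [CompleteSpace H]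

/-- The projection onto the blocks that the labelling `c` marks with the outcome `a`. -/
def labelProjection (R : Type*) [Zero R] [One R] (c : ι → A) (a : A) : Matrix ι ι R :=
  Matrix.diagonal fun i => if c i = a then 1 else 0

theorem isProjectiveMeasurement_labelProjection [Fintype A] (c : ι → A) :
    IsProjectiveMeasurement fun a => blockOp ι H (labelProjection _ c a) where
  selfAdjoint a := by
    refine IsSelfAdjoint.map ?_ (blockOp ι H)
    simp [IsSelfAdjoint, labelProjection, Matrix.star_eq_conjTranspose,
      Matrix.diagonal_conjTranspose, Pi.star_def, apply_ite]
  idem a := by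
    rw [← map_mul, labelProjection, Matrix.diagonal_mul_diagonal]
    simp only [ite_zero_mul_ite_zero, and_self, mul_one]
  orthogonal a a' h := by
    rw [← map_mul, labelProjection, labelProjection, Matrix.diagonal_mul_diagonal]
    convert map_zero (blockOp ι H)
    rw [Matrix.diagonal_eq_zero]
    funext i
    rw [ite_zero_mul_ite_zero, if_neg fun hi => h (hi.1.symm.trans hi.2), Pi.zero_apply]
  sum_eq_one := by
    rw [← map_sum]
    convert map_one (blockOp ι H)
    ext i j : 1
    by_cases h : i = j <;> simp [labelProjection, Matrix.sum_apply, Matrix.one_apply, h]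

/-- The Naimark dilation of a POVM `α` with outcomes listed by `e`: a block measurement, conjugated
by a unitary whose first column consists of the square roots of the `α a`. The first block is
labelled by the arbitrary outcome `a₀`. -/
def naimarkDilation (e : ι ≃ A) (a₀ : A) (α : A → H →L[ℂ] H) (a : A) :
    HilbertPower (Unit ⊕ ι) H →L[ℂ] HilbertPower (Unit ⊕ ι) H :=
  let W := dilationUnitary fun i => CFC.sqrt (α (e i))
  blockOp _ H (W * labelProjection _ (Sum.elim (fun _ => a₀) e) a * W)

variable {α : A → H →L[ℂ] H}

theorem isProjectiveMeasurement_naimarkDilation [Fintype A] (hα : IsPositiveMeasurement α)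
    (e : ι ≃ A) (a₀ : A) : IsProjectiveMeasurement (naimarkDilation e a₀ α) := by
  set W := dilationUnitary fun i => CFC.sqrt (α (e i))
  have hW_star : star W = W :=
    star_dilationUnitary fun i => (IsSelfAdjoint.of_nonneg (CFC.sqrt_nonneg _)).star_eq
  have hW_mul : W * W = 1 := by
    refine dilationUnitary_mul_self ?_
    simp_rw [CFC.sqrt_mul_sqrt_self _ (hα.nonneg _)]
    rw [e.sum_comp, hα.sum_eq_one]
  have hU : blockOp _ H W ∈ unitary (HilbertPower (Unit ⊕ ι) H →L[ℂ] _) :=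
    Unitary.map_mem (blockOp _ H) (by simp [Unitary.mem_iff, hW_star, hW_mul])
  convert (isProjectiveMeasurement_labelProjection (Sum.elim (fun _ => a₀) e)).conj hU with a
  rw [← map_star, hW_star, ← map_mul, ← map_mul, naimarkDilation]

theorem inner_naimarkDilation [Fintype A] (hα : IsPositiveMeasurement α) (e : ι ≃ A)
    (a₀ a : A) (v w : H) :
    inner ℂ (blockInclusion (Sum.inl ()) v)
      (naimarkDilation e a₀ α a (blockInclusion (Sum.inl ()) w)) = inner ℂ v (α a w) := by
  rw [naimarkDilation, inner_blockInclusion_blockOp, Matrix.mul_apply]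
  simp [labelProjection, dilationUnitary, CFC.sqrt_mul_sqrt_self _ (hα.nonneg _),
    ← e.eq_symm_apply]

theorem commute_naimarkDilation {T : H →L[ℂ] H} (hT : ∀ a, Commute T (α a)) (e : ι ≃ A)
    (a₀ a : A) : Commute (amplify _ H T) (naimarkDilation e a₀ α a) := by
  have hW := commute_dilationUnitary fun i =>
    (Commute.cfcₙ_nnreal (hT (e i)).symm NNReal.sqrt).symm
  refine commute_amplify_blockOp fun i j => ?_
  rw [Matrix.mul_apply]
  refine Commute.sum_right _ _ _ fun k _ => ?_
  rw [labelProjection, Matrix.mul_diagonal]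
  refine ((hW i k).mul_right ?_).mul_right (hW k j)
  split_ifs
  exacts [Commute.one_right T, Commute.zero_right T]

end Naimark

section MeasuredBehavior

variable {X Y A B H : Type*} [NormedAddCommGroup H] [InnerProductSpace ℂ H] {ψ : H}
  {α : X → A → H →L[ℂ] H} {β : Y → B → H →L[ℂ] H}

/-- The behavior of players who measure parts of the state `ψ`. The inner product is real whenever
the operators `α x a` and `β y b` are self-adjoint and commute. -/
def measuredBehavior (ψ : H) (α : X → A → H →L[ℂ] H) (β : Y → B → H →L[ℂ] H) : Behavior X Y A B :=
  fun x y a b => (inner ℂ ψ (α x a (β y b ψ))).re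

theorem measuredBehavior_nonneg [CompleteSpace H] {x : X} {y : Y} {a : A} {b : B}
    (hα : 0 ≤ α x a) (hβ : 0 ≤ β y b) (hc : Commute (α x a) (β y b)) :
    0 ≤ measuredBehavior ψ α β x y a b := by
  have h := (ContinuousLinearMap.nonneg_iff_isPositive _).1 (hc.mul_nonneg hα hβ)
  exact h.re_inner_nonneg_right ψ

theorem ofReal_measuredBehavior [CompleteSpace H] {x : X} {y : Y} {a : A} {b : B}
    (hα : IsSelfAdjoint (α x a)) (hβ : IsSelfAdjoint (β y b)) (hc : Commute (α x a) (β y b)) :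
    (measuredBehavior ψ α β x y a b : ℂ) = inner ℂ ψ (α x a (β y b ψ)) :=
  (ContinuousLinearMap.isSelfAdjoint_iff_isSymmetric.1
    ((hα.commute_iff hβ).1 hc)).coe_re_inner_self_apply ψ

variable [Fintype A] [Fintype B] [CompleteSpace H]

theorem isNonSignaling_measuredBehavior (hψ : ‖ψ‖ = 1) (hα : ∀ x, IsPositiveMeasurement (α x))
    (hβ : ∀ y, IsPositiveMeasurement (β y)) (hc : ∀ x y a b, Commute (α x a) (β y b)) :
    IsNonSignaling (measuredBehavior ψ α β) where
  nonneg x y a b := measuredBehavior_nonneg ((hα x).nonneg a) ((hβ y).nonneg b) (hc x y a b)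
  sum_eq_one x y := by
    simp only [measuredBehavior, ← Complex.re_sum, ← inner_sum, ← map_sum, ← sum_apply]
    simp [(hα x).sum_eq_one, (hβ y).sum_eq_one, hψ]
  marginal_alice a x y y' := by
    simp only [measuredBehavior, ← Complex.re_sum, ← inner_sum, ← map_sum, ← sum_apply]
    rw [(hβ y).sum_eq_one, (hβ y').sum_eq_one]
  marginal_bob b x x' y := by
    simp only [measuredBehavior, ← Complex.re_sum, ← inner_sum, ← sum_apply]
    rw [(hα x).sum_eq_one, (hα x').sum_eq_one]

/-- Commuting POVMs are compressions of commuting projective measurements on a larger space: Bob's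
are dilated after Alice's, with which they still commute by `commute_naimarkDilation`. -/
theorem measuredBehavior_mem_quantumSet {H : Type} [NormedAddCommGroup H] [InnerProductSpace ℂ H]
    [CompleteSpace H] {ψ : H} (hψ : ‖ψ‖ = 1) {α : X → A → H →L[ℂ] H} {β : Y → B → H →L[ℂ] H}
    (hα : ∀ x, IsPositiveMeasurement (α x)) (hβ : ∀ y, IsPositiveMeasurement (β y))
    (hc : ∀ x y a b, Commute (α x a) (β y b)) :
    measuredBehavior ψ α β ∈ quantumSet X Y A B := by
  classical
  have : Nontrivial H := ⟨ψ, 0, by rintro rfl; simp at hψ⟩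
  let eA := (Fintype.equivFin A).symm
  let eB := (Fintype.equivFin B).symm
  let E x := naimarkDilation eA (hα x).nonempty_outcome.some (α x)
  have hβ' y := (hβ y).map (amplify (Unit ⊕ Fin (Fintype.card A)) H)
  let F y := naimarkDilation eB (hβ y).nonempty_outcome.some
    fun b => amplify (Unit ⊕ Fin (Fintype.card A)) H (β y b)
  have hE x := isProjectiveMeasurement_naimarkDilation (hα x) eA (hα x).nonempty_outcome.some
  let π := amplify (Unit ⊕ Fin (Fintype.card B)) (HilbertPower (Unit ⊕ Fin (Fintype.card A)) H)
  refine ⟨_, inferInstance, inferInstance, inferInstance,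
    blockInclusion (Sum.inl ()) (blockInclusion (Sum.inl ()) ψ), fun x a => π (E x a), F,
    by simp [hψ], fun x => (hE x).map _,
    fun y => isProjectiveMeasurement_naimarkDilation (hβ' y) eB _, fun x y a b => ?_,
    fun x y a b => ?_⟩
  · exact commute_naimarkDilation
      (fun b => (commute_naimarkDilation (fun a => (hc x y a b).symm) eA _ a).symm) eB _ b
  · have hE_symm := ContinuousLinearMap.isSelfAdjoint_iff_isSymmetric.1 ((hE x).selfAdjoint a)
    have hπE_symm :=
      ContinuousLinearMap.isSelfAdjoint_iff_isSymmetric.1 (((hE x).map π).selfAdjoint a)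
    let J : H → _ := blockInclusion (ι := Unit ⊕ Fin (Fintype.card A)) (Sum.inl ())
    calc (measuredBehavior ψ α β x y a b : ℂ)
      _ = inner ℂ ψ (α x a (β y b ψ)) :=
        ofReal_measuredBehavior (.of_nonneg ((hα x).nonneg a)) (.of_nonneg ((hβ y).nonneg b))
          (hc x y a b)
      _ = inner ℂ (J ψ) (E x a (J (β y b ψ))) := (inner_naimarkDilation (hα x) ..).symm
      _ = inner ℂ (E x a (J ψ)) (amplify _ H (β y b) (J ψ)) := by
        rw [amplify_blockInclusion]
        exact (hE_symm _ _).symm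
      _ = inner ℂ (blockInclusion (Sum.inl ()) (E x a (J ψ)))
          (F y b (blockInclusion (Sum.inl ()) (J ψ))) := (inner_naimarkDilation (hβ' y) ..).symm
      _ = inner ℂ (blockInclusion (Sum.inl ()) (J ψ))
          (π (E x a) (F y b (blockInclusion (Sum.inl ()) (J ψ)))) := by
        rw [← amplify_blockInclusion]
        exact hπE_symm _ _

end MeasuredBehavior

section Postprocessing

variable {X Y A A' B B' H : Type*} [Fintype A] [DecidableEq A'] [Fintype B]
  [DecidableEq B'] [NormedAddCommGroup H] [InnerProductSpace ℂ H]

/-- The measurement followed by the relabelling `f` of its outcomes. -/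
def coarsen (f : A → A') (α : A → H →L[ℂ] H) (a' : A') : H →L[ℂ] H :=
  ∑ a with f a = a', α a

theorem IsPositiveMeasurement.coarsen [Fintype A'] [CompleteSpace H] {α : A → H →L[ℂ] H}
    (hα : IsPositiveMeasurement α) (f : A → A') : IsPositiveMeasurement (coarsen f α) where
  nonneg a' := Finset.sum_nonneg fun a _ => hα.nonneg a
  sum_eq_one := by
    simp_rw [_root_.coarsen]
    rw [Finset.sum_fiberwise, hα.sum_eq_one]

theorem postprocess_measuredBehavior (f : A → A') (g : B → B') (ψ : H) (α : X → A → H →L[ℂ] H)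
    (β : Y → B → H →L[ℂ] H) :
    postprocess (fun _ => f) (fun _ => g) (measuredBehavior ψ α β) =
      measuredBehavior ψ (fun x => coarsen f (α x)) fun y => coarsen g (β y) := by
  funext x y a' b'
  simp only [measuredBehavior, coarsen, sum_apply, map_sum, inner_sum, Complex.re_sum]
  rw [Finset.sum_comm]
  simp only [postprocess_apply, measuredBehavior, Finset.sum_filter, ite_and,
    Finset.sum_ite_irrel, Finset.sum_const_zero]

end Postprocessing

section ContainsProducts

variable {X Y A B : Type*} [Fintype A] [Fintype B]

theorem isPositiveMeasurement_of_mem_stdSimplex {α : A → ℝ} (hα : α ∈ stdSimplex ℝ A) :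
    IsPositiveMeasurement fun a => (α a : ℂ) • (1 : ℂ →L[ℂ] ℂ) where
  nonneg a := by
    rw [ContinuousLinearMap.nonneg_iff_isPositive]
    exact ContinuousLinearMap.isPositive_one.smul_of_nonneg (by exact_mod_cast hα.1 a)
  sum_eq_one := by
    rw [← Finset.sum_smul, ← Complex.ofReal_sum, hα.2]
    simp

theorem containsProducts_quantumSet : ContainsProducts (quantumSet X Y A B) := by
  intro α β hα hβ
  convert measuredBehavior_mem_quantumSet (ψ := (1 : ℂ)) (by simp)
    (fun x => isPositiveMeasurement_of_mem_stdSimplex (hα x))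
    (fun y => isPositiveMeasurement_of_mem_stdSimplex (hβ y)) fun x y a b => ?_
  · funext x y a b
    simp [productBehavior, measuredBehavior]
  · simp [Commute, SemiconjBy, smul_smul, mul_comm]

end ContainsProducts

/-! ### Tsirelson's realization of inner products -/

section Clifford

variable {ι : Type*} [Fintype ι] [DecidableEq ι]

/-- The sign `(-1) ^ n`, where `n` is the number of elements of `S` satisfying `r`. -/
def cliffordSign (r : ι → Prop) [DecidablePred r] (S : Finset ι) : ℂ :=
  ∏ k, if r k ∧ k ∈ S then -1 else 1

theorem cliffordSign_symmDiff (r : ι → Prop) [DecidablePred r] (S : Finset ι) (i : ι) :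
    cliffordSign r (symmDiff S {i}) = cliffordSign r S * if r i then -1 else 1 := by
  have h : ∀ k, (if r k ∧ k ∈ symmDiff S {i} then (-1 : ℂ) else 1) =
      (if r k ∧ k ∈ S then -1 else 1) * if k = i then (if r k then -1 else 1) else 1 := fun k => by
    by_cases hk : k = i <;> by_cases hr : r k <;> by_cases hS : k ∈ S <;>
      simp_all [Finset.mem_symmDiff]
  simp only [cliffordSign, h]
  rw [Finset.prod_mul_distrib, Finset.prod_ite_eq' Finset.univ i]
  simp

theorem cliffordSign_mul_self (r : ι → Prop) [DecidablePred r] (S : Finset ι) :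
    cliffordSign r S * cliffordSign r S = 1 := by
  rw [cliffordSign, ← Finset.prod_mul_distrib]
  exact Finset.prod_eq_one fun k _ => by split_ifs <;> simp

theorem star_cliffordSign (r : ι → Prop) [DecidablePred r] (S : Finset ι) :
    star (cliffordSign r S) = cliffordSign r S := by
  rw [cliffordSign, star_prod]
  exact Finset.prod_congr rfl fun k _ => by split_ifs <;> simp

/-- The generator `i` of the Clifford algebra acting on the span of all subsets of `ι`: it adds `i`
to a subset or removes it, with the sign that comes from moving `i` past the elements that precede
it in the order `r`. The reversed order describes multiplication from the other side. -/
def cliffordGenerator (r : ι → ι → Prop) [DecidableRel r] (i : ι) :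
    Matrix (Finset ι) (Finset ι) ℂ :=
  Matrix.of fun T S => if T = symmDiff S {i} then cliffordSign (r · i) S else 0

variable (r : ι → ι → Prop) [DecidableRel r]

theorem cliffordGenerator_mul (r' : ι → ι → Prop) [DecidableRel r'] (i j : ι) (T S : Finset ι) :
    (cliffordGenerator r i * cliffordGenerator r' j) T S =
      if T = symmDiff (symmDiff S {j}) {i} then
        cliffordSign (r · i) S * cliffordSign (r' · j) S * (if r j i then -1 else 1) else 0 := by
  rw [Matrix.mul_apply, Finset.sum_eq_single (symmDiff S {j})]
  · simp only [cliffordGenerator, Matrix.of_apply, if_true, cliffordSign_symmDiff]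
    rw [ite_mul, zero_mul]
    congr 1
    ring
  · intro U _ hU
    simp [cliffordGenerator, hU]
  · simp

theorem star_cliffordGenerator [Std.Irrefl r] (i : ι) :
    star (cliffordGenerator r i) = cliffordGenerator r i := by
  ext T S
  have h : S = symmDiff T {i} ↔ T = symmDiff S {i} := by
    constructor <;> rintro rfl <;> rw [symmDiff_symmDiff_cancel_right]
  simp only [Matrix.star_apply, cliffordGenerator, Matrix.of_apply, h]
  split_ifs with hT
  · rw [star_cliffordSign, hT, cliffordSign_symmDiff, if_neg (irrefl i), mul_one]
  · simp

theorem cliffordGenerator_anticommute [IsStrictTotalOrder ι r] (i j : ι) :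
    cliffordGenerator r i * cliffordGenerator r j + cliffordGenerator r j * cliffordGenerator r i =
      if i = j then 2 else 0 := by
  ext T S
  simp only [Matrix.add_apply, cliffordGenerator_mul]
  rw [symmDiff_right_comm S {j} {i}]
  rcases trichotomous_of r i j with h | rfl | h
  · simp only [h, asymm_of r h, ne_of_irrefl h, if_true, if_false, Matrix.zero_apply]
    split_ifs <;> ring
  · by_cases hT : T = S
    · simp only [hT, irrefl_of r i, symmDiff_symmDiff_cancel_right, cliffordSign_mul_self, if_true,
        if_false, Matrix.ofNat_apply]
      norm_num
    · simp [hT, Matrix.ofNat_apply]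
  · simp only [h, asymm_of r h, ne_of_irrefl' h, if_true, if_false, Matrix.zero_apply]
    split_ifs <;> ring

theorem commute_cliffordGenerator_swap (i j : ι) :
    Commute (cliffordGenerator r i) (cliffordGenerator (Function.swap r) j) := by
  ext T S
  simp only [cliffordGenerator_mul, Function.swap]
  rw [symmDiff_right_comm S {j} {i}, mul_comm (cliffordSign (r · i) S)]

theorem cliffordGenerator_empty (i : ι) : cliffordGenerator r i ∅ ∅ = 0 := by
  have h : symmDiff (∅ : Finset ι) {i} = {i} := bot_symmDiff _
  simp [cliffordGenerator, h, (Finset.singleton_ne_empty i).symm]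

theorem cliffordGenerator_mul_empty [Std.Irrefl r] (r' : ι → ι → Prop) [DecidableRel r']
    (i j : ι) :
    (cliffordGenerator r i * cliffordGenerator r' j) ∅ ∅ = if i = j then 1 else 0 := by
  have h : (∅ : Finset ι) = symmDiff (symmDiff ∅ {j}) {i} ↔ i = j := by
    rw [show symmDiff (∅ : Finset ι) {j} = {j} from bot_symmDiff _, eq_comm,
      show (∅ : Finset ι) = ⊥ from rfl, symmDiff_eq_bot, Finset.singleton_inj, eq_comm]
  simp only [cliffordGenerator_mul, h]
  rcases eq_or_ne i j with rfl | hij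
  · simp [cliffordSign, irrefl i]
  · simp [hij]

/-- The embedding of a Euclidean space into its Clifford algebra. -/
def cliffordVector (u : EuclideanSpace ℝ ι) : Matrix (Finset ι) (Finset ι) ℂ :=
  ∑ i, (u i : ℂ) • cliffordGenerator r i

theorem star_cliffordVector [Std.Irrefl r] (u : EuclideanSpace ℝ ι) :
    star (cliffordVector r u) = cliffordVector r u := by
  simp [cliffordVector, star_cliffordGenerator]

theorem cliffordVector_mul_self [IsStrictTotalOrder ι r] (u : EuclideanSpace ℝ ι) :
    cliffordVector r u * cliffordVector r u = ((‖u‖ ^ 2 : ℝ) : ℂ) • 1 := by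
  have h_sum : cliffordVector r u * cliffordVector r u =
      ∑ i, ∑ j, ((u i : ℂ) * u j) • (cliffordGenerator r i * cliffordGenerator r j) := by
    simp only [cliffordVector, Finset.sum_mul_sum, smul_mul_smul_comm]
  have h_swap : cliffordVector r u * cliffordVector r u =
      ∑ i, ∑ j, ((u i : ℂ) * u j) • (cliffordGenerator r j * cliffordGenerator r i) := by
    rw [h_sum, Finset.sum_comm]
    simp only [mul_comm]
  have h_two : (2 : ℂ) • (cliffordVector r u * cliffordVector r u) =
      (2 : ℂ) • ((‖u‖ ^ 2 : ℝ) : ℂ) • 1 := by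
    rw [two_smul]
    nth_rw 1 [h_sum]
    rw [h_swap, EuclideanSpace.real_norm_sq_eq]
    simp only [← Finset.sum_add_distrib, ← smul_add, cliffordGenerator_anticommute, smul_ite,
      smul_zero, Finset.sum_ite_eq, Finset.mem_univ, if_true, ← Finset.sum_smul]
    rw [smul_comm]
    norm_num [sq, ofNat_smul_eq_nsmul]
  exact smul_right_injective _ (two_ne_zero (α := ℂ)) h_two

theorem commute_cliffordVector_swap (u v : EuclideanSpace ℝ ι) :
    Commute (cliffordVector r u) (cliffordVector (Function.swap r) v) :=
  Commute.sum_left _ _ _ fun i _ => Commute.sum_right _ _ _ fun j _ =>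
    ((commute_cliffordGenerator_swap r i j).smul_left _).smul_right _

theorem cliffordVector_empty (u : EuclideanSpace ℝ ι) : cliffordVector r u ∅ ∅ = 0 := by
  simp [cliffordVector, Matrix.sum_apply, cliffordGenerator_empty]

theorem cliffordVector_mul_empty [Std.Irrefl r] (r' : ι → ι → Prop) [DecidableRel r']
    (u v : EuclideanSpace ℝ ι) :
    (cliffordVector r u * cliffordVector r' v) ∅ ∅ = ((inner ℝ u v : ℝ) : ℂ) := by
  simp only [cliffordVector, Finset.sum_mul_sum, smul_mul_smul_comm, Matrix.sum_apply,
    Matrix.smul_apply, cliffordGenerator_mul_empty]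
  simp [PiLp.inner_apply, mul_comm]

end Clifford

section SignMeasurement

variable {X Y H : Type*} [NormedAddCommGroup H] [InnerProductSpace ℂ H]

/-- The measurement with outcomes `±1` and expectation operator `T`, which is a POVM when `T` is a
self-adjoint contraction. -/
def signMeasurement (T : H →L[ℂ] H) (a : ℤˣ) : H →L[ℂ] H :=
  (1 / 2 : ℂ) • (1 + ((a : ℤ) : ℂ) • T)

theorem isPositiveMeasurement_signMeasurement [CompleteSpace H] {T : H →L[ℂ] H}
    (hT : IsSelfAdjoint T) (hT' : ‖T‖ ≤ 1) : IsPositiveMeasurement (signMeasurement T) where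
  nonneg a := by
    have haT : IsSelfAdjoint (((a : ℤ) : ℂ) • T) := by
      rcases Int.units_eq_one_or a with rfl | rfl <;> simp [hT.neg, hT]
    have haT' : ‖((a : ℤ) : ℂ) • T‖ ≤ 1 := by
      rcases Int.units_eq_one_or a with rfl | rfl <;> simpa using hT'
    have h : -1 ≤ ((a : ℤ) : ℂ) • T := by
      calc -(1 : H →L[ℂ] H) ≤ -algebraMap ℝ (H →L[ℂ] H) ‖((a : ℤ) : ℂ) • T‖ :=
            neg_le_neg (by simpa using algebraMap_mono (H →L[ℂ] H) haT')
        _ ≤ ((a : ℤ) : ℂ) • T := haT.neg_algebraMap_norm_le_self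
    refine (ContinuousLinearMap.nonneg_iff_isPositive _).2 (.smul_of_nonneg ?_ ?_)
    · exact (ContinuousLinearMap.nonneg_iff_isPositive _).1 (neg_le_iff_add_nonneg'.1 h)
    · rw [RCLike.nonneg_iff]
      norm_num
  sum_eq_one := by
    rw [UnitsInt.univ, Finset.sum_insert (by decide), Finset.sum_singleton]
    simp only [signMeasurement, Units.val_one, Units.val_neg, Int.cast_one, Int.cast_neg]
    module

theorem commute_signMeasurement {S T : H →L[ℂ] H} (h : Commute S T) (a b : ℤˣ) :
    Commute (signMeasurement S a) (signMeasurement T b) :=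
  ((((Commute.one_left _).add_left
    (((Commute.one_right _).add_right (h.smul_right _)).smul_left _)).smul_right _).smul_left _)

theorem measuredBehavior_signMeasurement {ψ : H} (hψ : ‖ψ‖ = 1) {S : X → H →L[ℂ] H}
    {T : Y → H →L[ℂ] H} (hS : ∀ x, inner ℂ ψ (S x ψ) = 0) (hT : ∀ y, inner ℂ ψ (T y ψ) = 0) :
    measuredBehavior ψ (fun x => signMeasurement (S x)) (fun y => signMeasurement (T y)) =
      ofCorrelation fun x y => (inner ℂ ψ (S x (T y ψ))).re := by
  funext x y a b
  have h_expand : signMeasurement (S x) a (signMeasurement (T y) b ψ) =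
      (1 / 4 : ℂ) • (ψ + ((a : ℤ) : ℂ) • S x ψ + ((b : ℤ) : ℂ) • T y ψ +
        (((a : ℤ) : ℂ) * ((b : ℤ) : ℂ)) • S x (T y ψ)) := by
    simp only [signMeasurement, smul_apply, add_apply, one_apply_eq_self, map_smul, map_add]
    module
  rw [measuredBehavior, h_expand, ofCorrelation]
  simp only [inner_smul_right, inner_add_right, hS, hT, inner_self_eq_norm_sq_to_K, hψ]
  rcases Int.units_eq_one_or a with rfl | rfl <;> rcases Int.units_eq_one_or b with rfl | rfl <;>
    simp <;> ring

end SignMeasurement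

theorem ofCorrelation_inner_mem_quantumSet_euclideanSpace {X Y : Type*} {m : ℕ}
    {u : X → EuclideanSpace ℝ (Fin m)} {v : Y → EuclideanSpace ℝ (Fin m)} (hu : ∀ x, ‖u x‖ ≤ 1)
    (hv : ∀ y, ‖v y‖ ≤ 1) :
    ofCorrelation (fun x y => inner ℝ (u x) (v y)) ∈ quantumSet X Y ℤˣ ℤˣ := by
  let Φ := Matrix.toEuclideanCLM (n := Finset (Fin m)) (𝕜 := ℂ)
  let ψ : EuclideanSpace ℂ (Finset (Fin m)) := EuclideanSpace.single ∅ 1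
  have hψ : ‖ψ‖ = 1 := by simp [ψ]
  have h_inner N : inner ℂ ψ (Φ N ψ) = N ∅ ∅ := by
    simp [Φ, ψ, EuclideanSpace.inner_single_left]
  have h_measurement (r : Fin m → Fin m → Prop) [DecidableRel r] [IsStrictTotalOrder _ r]
      {w : EuclideanSpace ℝ (Fin m)} (hw : ‖w‖ ≤ 1) :
      IsPositiveMeasurement (signMeasurement (Φ (cliffordVector r w))) := by
    have h_star : IsSelfAdjoint (Φ (cliffordVector r w)) :=
      IsSelfAdjoint.map (star_cliffordVector r w) Φ
    refine isPositiveMeasurement_signMeasurement h_star ?_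
    have h_sq : ‖Φ (cliffordVector r w)‖ * ‖Φ (cliffordVector r w)‖ ≤ 1 := by
      rw [← CStarRing.norm_star_mul_self, h_star.star_eq, ← map_mul, cliffordVector_mul_self,
        map_smul, map_one, norm_smul, Complex.norm_of_nonneg (by positivity)]
      exact mul_le_one₀ (pow_le_one₀ (norm_nonneg _) hw) (norm_nonneg _)
        ContinuousLinearMap.norm_id_le
    nlinarith [norm_nonneg (Φ (cliffordVector r w))]
  convert measuredBehavior_mem_quantumSet hψ (fun x => h_measurement (· < ·) (hu x))
    (fun y => h_measurement (Function.swap (· < ·)) (hv y)) fun x y a b =>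
      commute_signMeasurement ((commute_cliffordVector_swap (· < ·) (u x) (v y)).map Φ) a b
  rw [measuredBehavior_signMeasurement hψ (by simp [h_inner, cliffordVector_empty])
    (by simp [h_inner, cliffordVector_empty])]
  congr! 3 with x y
  rw [← mul_apply_eq_comp, ← map_mul, h_inner, cliffordVector_mul_empty, Complex.ofReal_re]

theorem ofCorrelation_inner_mem_quantumSet {X Y : Type*} [Finite X] [Finite Y] {K : Type*}
    [NormedAddCommGroup K] [InnerProductSpace ℝ K] {u : X → K} {v : Y → K} (hu : ∀ x, ‖u x‖ ≤ 1)
    (hv : ∀ y, ‖v y‖ ≤ 1) :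
    ofCorrelation (fun x y => inner ℝ (u x) (v y)) ∈ quantumSet X Y ℤˣ ℤˣ := by
  let W : Submodule ℝ K := Submodule.span ℝ (Set.range u ∪ Set.range v)
  have : FiniteDimensional ℝ W :=
    FiniteDimensional.span_of_finite ℝ ((Set.finite_range u).union (Set.finite_range v))
  let u' : X → W := fun x => ⟨u x, Submodule.subset_span (Or.inl ⟨x, rfl⟩)⟩
  let v' : Y → W := fun y => ⟨v y, Submodule.subset_span (Or.inr ⟨y, rfl⟩)⟩
  let e := (stdOrthonormalBasis ℝ W).repr
  have h := ofCorrelation_inner_mem_quantumSet_euclideanSpace (u := fun x => e (u' x))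
    (v := fun y => e (v' y)) (fun x => (e.norm_map _).trans_le (hu x))
    fun y => (e.norm_map _).trans_le (hv y)
  simp only [e.inner_map_map] at h
  exact h

/-! ### Entangled pairs and postselected teleportation -/

section EntangledPairs

variable {n R : Type*} [Fintype n] [DecidableEq n] [Ring R] [Algebra ℂ R] [StarRing R]

/-- The projection onto the maximally entangled state `∑ a, |aa⟩ / √n` of two systems with `n`
levels, whose operators are given by commuting representations `ρ` and `σ` of the matrices. -/
def eprProj (ρ σ : Matrix n n ℂ →⋆ₐ[ℂ] R) : R :=
  (Fintype.card n : ℂ)⁻¹ • ∑ a, ∑ b, ρ (Matrix.single a b 1) * σ (Matrix.single a b 1)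

/-- The operator exchanging two systems with `n` levels, given as in `eprProj`. -/
def swapOp (ρ σ : Matrix n n ℂ →⋆ₐ[ℂ] R) : R :=
  ∑ a, ∑ b, ρ (Matrix.single a b 1) * σ (Matrix.single b a 1)

variable {ρ σ τ : Matrix n n ℂ →⋆ₐ[ℂ] R}

theorem commute_eprProj {T : R} (hρ : ∀ M, Commute T (ρ M)) (hσ : ∀ M, Commute T (σ M)) :
    Commute T (eprProj ρ σ) :=
  (Commute.sum_right _ _ _ fun _ _ => Commute.sum_right _ _ _ fun _ _ =>
    (hρ _).mul_right (hσ _)).smul_right _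

theorem commute_swapOp {T : R} (hρ : ∀ M, Commute T (ρ M)) (hσ : ∀ M, Commute T (σ M)) :
    Commute T (swapOp ρ σ) :=
  Commute.sum_right _ _ _ fun _ _ => Commute.sum_right _ _ _ fun _ _ => (hρ _).mul_right (hσ _)

theorem map_eprProj {R' : Type*} [Ring R'] [Algebra ℂ R'] [StarRing R'] (π : R →⋆ₐ[ℂ] R') :
    π (eprProj ρ σ) = eprProj (π.comp ρ) (π.comp σ) := by
  simp only [eprProj, map_smul, map_sum, map_mul, StarAlgHom.comp_apply]

theorem map_single_mul_map_single (a b c d : n) :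
    ρ (Matrix.single a b 1) * ρ (Matrix.single c d 1) =
      if b = c then ρ (Matrix.single a d 1) else 0 := by
  rw [← map_mul]
  split_ifs with h
  · rw [h, Matrix.single_mul_single_same, mul_one]
  · rw [Matrix.single_mul_single_of_ne _ _ _ _ h, map_zero]

theorem star_map_single (a b : n) :
    star (ρ (Matrix.single a b 1)) = ρ (Matrix.single b a 1) := by
  rw [← map_star, Matrix.star_eq_conjTranspose, Matrix.conjTranspose_single, star_one]

theorem sum_map_single_self : ∑ a, ρ (Matrix.single a a 1) = 1 := by
  rw [← map_sum, Matrix.sum_single_one, map_one]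

theorem star_eprProj [StarModule ℂ R] (h : ∀ M N, Commute (ρ M) (σ N)) :
    star (eprProj ρ σ) = eprProj ρ σ := by
  simp only [eprProj, star_smul, star_sum, star_mul, star_map_single, (h _ _).eq, star_inv₀,
    star_natCast]
  rw [Finset.sum_comm]

theorem eprProj_mul_self (h : ∀ M N, Commute (ρ M) (σ N)) :
    eprProj ρ σ * eprProj ρ σ = eprProj ρ σ := by
  have hunits a b c d : ρ (Matrix.single a b 1) * σ (Matrix.single a b 1) *
      (ρ (Matrix.single c d 1) * σ (Matrix.single c d 1)) =
      if b = c then ρ (Matrix.single a d 1) * σ (Matrix.single a d 1) else 0 := by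
    rw [(h _ _).symm.mul_mul_mul_comm, map_single_mul_map_single, map_single_mul_map_single]
    split_ifs <;> simp
  have hsum : (∑ a, ∑ b, ρ (Matrix.single a b 1) * σ (Matrix.single a b 1)) *
      (∑ a, ∑ b, ρ (Matrix.single a b 1) * σ (Matrix.single a b 1)) =
      (Fintype.card n : ℂ) • ∑ a, ∑ b, ρ (Matrix.single a b 1) * σ (Matrix.single a b 1) := by
    simp only [Finset.sum_mul_sum, hunits, Finset.sum_ite_irrel, Finset.sum_const_zero,
      Finset.sum_ite_eq', Finset.mem_univ, if_true, Finset.sum_const, Finset.card_univ,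
      Finset.smul_sum, Nat.cast_smul_eq_nsmul]
  rw [eprProj, smul_mul_smul_comm, hsum, smul_smul]
  by_cases hn : (Fintype.card n : ℂ) = 0
  · rw [hn, inv_zero, zero_mul, zero_mul]
  · rw [inv_mul_cancel_right₀ hn]

theorem star_swapOp (h : ∀ M N, Commute (ρ M) (σ N)) : star (swapOp ρ σ) = swapOp ρ σ := by
  simp only [swapOp, star_sum, star_mul, star_map_single, (h _ _).eq]
  rw [Finset.sum_comm]

theorem swapOp_mul_self (h : ∀ M N, Commute (ρ M) (σ N)) : swapOp ρ σ * swapOp ρ σ = 1 := by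
  have hunits a b c d : ρ (Matrix.single a b 1) * σ (Matrix.single b a 1) *
      (ρ (Matrix.single c d 1) * σ (Matrix.single d c 1)) =
      if b = c then if a = d then ρ (Matrix.single a a 1) * σ (Matrix.single b b 1) else 0
      else 0 := by
    rw [(h _ _).symm.mul_mul_mul_comm, map_single_mul_map_single, map_single_mul_map_single]
    split_ifs <;> simp_all
  simp only [swapOp, Finset.sum_mul_sum, hunits, Finset.sum_ite_irrel, Finset.sum_const_zero,
    Finset.sum_ite_eq, Finset.sum_ite_eq', Finset.mem_univ, if_true]
  rw [← Finset.sum_mul_sum, sum_map_single_self, sum_map_single_self, one_mul]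

theorem swapOp_mem_unitary (h : ∀ M N, Commute (ρ M) (σ N)) : swapOp ρ σ ∈ unitary R := by
  rw [Unitary.mem_iff, star_swapOp h, swapOp_mul_self h, and_self]

theorem swapOp_mul_map_single (h : ∀ M N, Commute (ρ M) (σ N)) (c d : n) :
    swapOp ρ σ * ρ (Matrix.single c d 1) = σ (Matrix.single c d 1) * swapOp ρ σ := by
  have hleft a b : ρ (Matrix.single a b 1) * σ (Matrix.single b a 1) * ρ (Matrix.single c d 1) =
      if b = c then ρ (Matrix.single a d 1) * σ (Matrix.single c a 1) else 0 := by
    rw [mul_assoc, ← (h _ _).eq, ← mul_assoc, map_single_mul_map_single]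
    split_ifs <;> simp_all
  have hright a b : σ (Matrix.single c d 1) *
      (ρ (Matrix.single a b 1) * σ (Matrix.single b a 1)) =
      if d = b then ρ (Matrix.single a d 1) * σ (Matrix.single c a 1) else 0 := by
    rw [← mul_assoc, ← (h _ _).eq, mul_assoc, map_single_mul_map_single]
    split_ifs <;> simp_all
  simp only [swapOp, Finset.sum_mul, Finset.mul_sum, hleft, hright, Finset.sum_ite_eq,
    Finset.sum_ite_eq', Finset.mem_univ, if_true]

theorem swapOp_mul_map (h : ∀ M N, Commute (ρ M) (σ N)) (M : Matrix n n ℂ) :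
    swapOp ρ σ * ρ M = σ M * swapOp ρ σ := by
  have hM : M = ∑ c, ∑ d, M c d • Matrix.single c d 1 := by
    simpa only [Matrix.smul_single, smul_eq_mul, mul_one] using Matrix.matrix_eq_sum_single M
  rw [hM]
  simp only [map_sum, map_smul, Finset.mul_sum, Finset.sum_mul, mul_smul_comm, smul_mul_assoc,
    swapOp_mul_map_single h]

/-- Postselected teleportation: projecting a system and one half of an entangled pair onto the
entangled state moves the system to the other half, with amplitude `1 / n`. -/
theorem eprProj_mul_eprProj (hστ : ∀ M N, Commute (σ M) (τ N)) :
    eprProj ρ σ * eprProj σ τ =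
      (Fintype.card n : ℂ)⁻¹ • (swapOp ρ τ * eprProj σ τ) := by
  have hleft a b c d : ρ (Matrix.single a b 1) * σ (Matrix.single a b 1) *
      (σ (Matrix.single c d 1) * τ (Matrix.single c d 1)) =
      if b = c then ρ (Matrix.single a b 1) * σ (Matrix.single a d 1) * τ (Matrix.single b d 1)
      else 0 := by
    rw [mul_assoc, ← mul_assoc (σ _), map_single_mul_map_single]
    split_ifs <;> simp_all [mul_assoc]
  have hright a b c d : ρ (Matrix.single a b 1) * τ (Matrix.single b a 1) *
      (σ (Matrix.single c d 1) * τ (Matrix.single c d 1)) =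
      if a = c then ρ (Matrix.single a b 1) * σ (Matrix.single a d 1) * τ (Matrix.single b d 1)
      else 0 := by
    rw [(hστ _ _).eq, mul_assoc, ← mul_assoc (τ _), map_single_mul_map_single]
    split_ifs with h
    · rw [← h, ← (hστ _ _).eq, mul_assoc]
    · rw [zero_mul, mul_zero]
  have hsum : (∑ a, ∑ b, ρ (Matrix.single a b 1) * σ (Matrix.single a b 1)) *
      (∑ c, ∑ d, σ (Matrix.single c d 1) * τ (Matrix.single c d 1)) =
      swapOp ρ τ * ∑ c, ∑ d, σ (Matrix.single c d 1) * τ (Matrix.single c d 1) := by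
    simp only [swapOp, Finset.sum_mul_sum, hleft, hright, Finset.sum_ite_irrel,
      Finset.sum_const_zero, Finset.sum_ite_eq, Finset.sum_ite_eq', Finset.mem_univ, if_true]
  rw [eprProj, eprProj, smul_mul_smul_comm, hsum, mul_smul_comm, smul_smul]

end EntangledPairs

section MatrixFactors

open scoped Kronecker

variable (ι : Type*) [Fintype ι] [DecidableEq ι]

/-- The action of matrices on the first tensor factor. -/
def leftFactor : Matrix ι ι ℂ →⋆ₐ[ℂ] Matrix (ι × ι) (ι × ι) ℂ where
  toFun M := M ⊗ₖ 1
  map_one' := Matrix.one_kronecker_one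
  map_mul' M N := by rw [← Matrix.mul_kronecker_mul, one_mul]
  map_zero' := Matrix.zero_kronecker _
  map_add' M N := Matrix.add_kronecker _ _ _
  commutes' c := by
    rw [Algebra.algebraMap_eq_smul_one, Algebra.algebraMap_eq_smul_one, Matrix.smul_kronecker,
      Matrix.one_kronecker_one]
  map_star' M := by
    rw [Matrix.star_eq_conjTranspose, Matrix.star_eq_conjTranspose,
      Matrix.conjTranspose_kronecker, Matrix.conjTranspose_one]

/-- The action of matrices on the second tensor factor. -/
def rightFactor : Matrix ι ι ℂ →⋆ₐ[ℂ] Matrix (ι × ι) (ι × ι) ℂ where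
  toFun M := 1 ⊗ₖ M
  map_one' := Matrix.one_kronecker_one
  map_mul' M N := by rw [← Matrix.mul_kronecker_mul, one_mul]
  map_zero' := Matrix.kronecker_zero _
  map_add' M N := Matrix.kronecker_add _ _ _
  commutes' c := by
    rw [Algebra.algebraMap_eq_smul_one, Algebra.algebraMap_eq_smul_one, Matrix.kronecker_smul,
      Matrix.one_kronecker_one]
  map_star' M := by
    rw [Matrix.star_eq_conjTranspose, Matrix.star_eq_conjTranspose,
      Matrix.conjTranspose_kronecker, Matrix.conjTranspose_one]

variable {ι}

theorem leftFactor_mul_rightFactor (M N : Matrix ι ι ℂ) :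
    leftFactor ι M * rightFactor ι N = M ⊗ₖ N := by
  change (M ⊗ₖ 1) * (1 ⊗ₖ N) = _
  rw [← Matrix.mul_kronecker_mul, one_mul, mul_one]

theorem commute_leftFactor_rightFactor (M N : Matrix ι ι ℂ) :
    Commute (leftFactor ι M) (rightFactor ι N) := by
  rw [Commute, SemiconjBy, leftFactor_mul_rightFactor]
  change _ = (1 ⊗ₖ N) * (M ⊗ₖ 1)
  rw [← Matrix.mul_kronecker_mul, one_mul, mul_one]

theorem eprProj_factors_apply (i j : ι × ι) :
    eprProj (leftFactor ι) (rightFactor ι) i j =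
      if i.1 = i.2 ∧ j.1 = j.2 then (Fintype.card ι : ℂ)⁻¹ else 0 := by
  have hunits a b : (Matrix.single a b 1 ⊗ₖ Matrix.single a b 1 : Matrix _ _ ℂ) i j =
      if a = i.1 then if b = j.1 then if i.1 = i.2 ∧ j.1 = j.2 then 1 else 0 else 0 else 0 := by
    rw [Matrix.kroneckerMap_apply, Matrix.single_apply, Matrix.single_apply]
    grind
  simp only [eprProj, leftFactor_mul_rightFactor, Matrix.smul_apply, Matrix.sum_apply, hunits,
    Finset.sum_ite_irrel, Finset.sum_const_zero, Finset.sum_ite_eq', Finset.mem_univ, if_true,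
    smul_eq_mul, mul_ite, mul_one, mul_zero]

theorem eprProj_factors_mulVec [Nonempty ι] (c : ℂ) :
    (eprProj (leftFactor ι) (rightFactor ι)).mulVec (fun i => if i.1 = i.2 then c else 0) =
      fun i => if i.1 = i.2 then c else 0 := by
  funext ⟨i, j⟩
  by_cases h : i = j
  · simp [Matrix.mulVec, dotProduct, eprProj_factors_apply, Fintype.sum_prod_type, h]
  · simp [Matrix.mulVec, dotProduct, eprProj_factors_apply, h]

end MatrixFactors

section EntangledExtension

variable {ι H : Type*} [Fintype ι] [DecidableEq ι] [NormedAddCommGroup H] [InnerProductSpace ℂ H]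
  [CompleteSpace H]

variable (ι H) in
/-- Matrices of numbers act on a direct sum of copies of `H`. -/
def scalarOp : Matrix ι ι ℂ →⋆ₐ[ℂ] (HilbertPower ι H →L[ℂ] HilbertPower ι H) :=
  (blockOp ι H).comp
    { (Algebra.ofId ℂ (H →L[ℂ] H)).mapMatrix with
      map_star' := fun M => by
        ext i j : 1
        simp [Matrix.star_apply, Algebra.ofId_apply, Algebra.algebraMap_eq_smul_one] }

theorem scalarOp_eq (M : Matrix ι ι ℂ) :
    scalarOp ι H M = blockOp ι H (M.map (algebraMap ℂ (H →L[ℂ] H))) := rfl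

theorem scalarOp_apply (M : Matrix ι ι ℂ) (v : HilbertPower ι H) (i : ι) :
    scalarOp ι H M v i = ∑ j, M i j • v j := by
  rw [scalarOp_eq, blockOp_apply]
  simp only [Matrix.map_apply, Algebra.algebraMap_eq_smul_one, smul_apply, one_apply_eq_self]

theorem commute_scalarOp_amplify (M : Matrix ι ι ℂ) (T : H →L[ℂ] H) :
    Commute (scalarOp ι H M) (amplify ι H T) :=
  (commute_amplify_blockOp fun i j => (Algebra.commutes (M i j) T).symm).symm

theorem scalarOp_tensorIsometry {M : Matrix ι ι ℂ} {c : ι → ℂ} {hc : ∑ i, ‖c i‖ ^ 2 = 1}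
    (h : M.mulVec c = c) (v : H) :
    scalarOp ι H M (tensorIsometry c hc v) = tensorIsometry c hc v := by
  ext i
  rw [scalarOp_apply]
  have := congrArg (· • v) (congrFun h i)
  simpa [Matrix.mulVec, dotProduct, Finset.sum_smul, smul_smul] using this

theorem amplify_tensorIsometry {c : ι → ℂ} {hc : ∑ i, ‖c i‖ ^ 2 = 1} (T : H →L[ℂ] H) (v : H) :
    amplify ι H T (tensorIsometry c hc v) = tensorIsometry c hc (T v) := by
  ext i
  rw [amplify_apply, tensorIsometry_apply, tensorIsometry_apply, map_smul]

/-- The space `K` arises from `H` by adding `q` maximally entangled pairs of qubits. The vector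
`v` of `H` becomes `incl v`, in which all pairs are entangled, the operator `T` on `H` becomes
`amp T`, and `half (j, s)` is the action of matrices on one of the two qubits (`s = false` and
`s = true`) of pair `j`. -/
structure EntangledExtension (q : ℕ) (H K : Type*) [NormedAddCommGroup H]
    [InnerProductSpace ℂ H] [CompleteSpace H] [NormedAddCommGroup K] [InnerProductSpace ℂ K]
    [CompleteSpace K] where
  incl : H →ₗᵢ[ℂ] K
  amp : (H →L[ℂ] H) →⋆ₐ[ℂ] (K →L[ℂ] K)
  half : Fin q × Bool → Matrix (Fin 2) (Fin 2) ℂ →⋆ₐ[ℂ] (K →L[ℂ] K)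
  amp_incl : ∀ T v, amp T (incl v) = incl (T v)
  commute_half_amp : ∀ i M T, Commute (half i M) (amp T)
  commute_half : ∀ i j, i ≠ j → ∀ M N, Commute (half i M) (half j N)
  eprProj_incl : ∀ j v, eprProj (half (j, false)) (half (j, true)) (incl v) = incl v

namespace EntangledExtension

variable {K L : Type*} [NormedAddCommGroup K] [InnerProductSpace ℂ K] [CompleteSpace K]
  [NormedAddCommGroup L] [InnerProductSpace ℂ L] [CompleteSpace L]

variable (H) in
/-- No pairs are added. -/
def refl : EntangledExtension 0 H H where
  incl := LinearIsometry.id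
  amp := StarAlgHom.id ℂ _
  half i := i.1.elim0
  amp_incl _ _ := rfl
  commute_half_amp i := i.1.elim0
  commute_half i := i.1.elim0
  eprProj_incl j := j.elim0

variable (H) in
/-- One pair is added by passing to `ℂ² ⊗ ℂ² ⊗ H`. -/
def onePair : EntangledExtension 1 H (HilbertPower (Fin 2 × Fin 2) H) where
  incl := tensorIsometry (fun i => if i.1 = i.2 then ((√2)⁻¹ : ℝ) else 0) (by
    simp [Fintype.sum_prod_type, apply_ite, ite_pow])
  amp := amplify _ H
  half i := (scalarOp _ H).comp (bif i.2 then rightFactor (Fin 2) else leftFactor (Fin 2))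
  amp_incl := amplify_tensorIsometry
  commute_half_amp _ _ _ := commute_scalarOp_amplify _ _
  commute_half := by
    rintro ⟨i, s⟩ ⟨j, t⟩ hij M N
    obtain rfl := Subsingleton.elim i j
    refine Commute.map ?_ (scalarOp _ H)
    cases s <;> cases t
    · exact absurd rfl hij
    · exact commute_leftFactor_rightFactor M N
    · exact (commute_leftFactor_rightFactor N M).symm
    · exact absurd rfl hij
  eprProj_incl _ v := by
    rw [cond_false, cond_true, ← map_eprProj]
    exact scalarOp_tensorIsometry (eprProj_factors_mulVec _) v

/-- A pair is added in front of those of `E`. -/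
def cons (F : EntangledExtension 1 K L) {q : ℕ} (E : EntangledExtension q H K) :
    EntangledExtension (q + 1) H L where
  incl := F.incl.comp E.incl
  amp := F.amp.comp E.amp
  half i := Fin.cases (F.half (0, i.2)) (fun j => F.amp.comp (E.half (j, i.2))) i.1
  amp_incl T v := by
    simp only [StarAlgHom.comp_apply, LinearIsometry.coe_comp, Function.comp_apply, F.amp_incl,
      E.amp_incl]
  commute_half_amp := by
    rintro ⟨i, s⟩ M T
    cases i using Fin.cases with
    | zero => exact F.commute_half_amp (0, s) M _
    | succ i => exact (E.commute_half_amp (i, s) M T).map F.amp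
  commute_half := by
    rintro ⟨i, s⟩ ⟨j, t⟩ hij M N
    cases i using Fin.cases with
    | zero =>
      cases j using Fin.cases with
      | zero => exact F.commute_half (0, s) (0, t) (by aesop) M N
      | succ j => exact F.commute_half_amp (0, s) M _
    | succ i =>
      cases j using Fin.cases with
      | zero => exact (F.commute_half_amp (0, t) N _).symm
      | succ j => exact (E.commute_half (i, s) (j, t) (by aesop) M N).map F.amp
  eprProj_incl j v := by
    cases j using Fin.cases with
    | zero => exact F.eprProj_incl 0 _
    | succ j =>
      simp only [Fin.cases_succ, ← map_eprProj, LinearIsometry.coe_comp, Function.comp_apply,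
        F.amp_incl, E.eprProj_incl]

end EntangledExtension

theorem exists_entangledExtension.{u} (q : ℕ) (H : Type u) [NormedAddCommGroup H]
    [InnerProductSpace ℂ H] [CompleteSpace H] :
    ∃ (K : Type u) (_ : NormedAddCommGroup K) (_ : InnerProductSpace ℂ K) (_ : CompleteSpace K),
      Nonempty (EntangledExtension q H K) := by
  induction q with
  | zero => exact ⟨H, inferInstance, inferInstance, inferInstance, ⟨.refl H⟩⟩
  | succ q ih =>
    obtain ⟨K, _, _, _, ⟨E⟩⟩ := ih
    exact ⟨_, inferInstance, inferInstance, inferInstance, ⟨.cons (.onePair K) E⟩⟩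

end EntangledExtension

/-! ### Teleporting the message qubits of a protocol -/

theorem commute_of_mem_starAdjoin {R : Type*} [Ring R] [Algebra ℂ R] [StarRing R] [StarModule ℂ R]
    {s t : Set R} (h : ∀ a ∈ s, ∀ b ∈ t, Commute a b ∧ Commute a (star b)) {a b : R}
    (ha : a ∈ StarAlgebra.adjoin ℂ s) (hb : b ∈ StarAlgebra.adjoin ℂ t) : Commute a b := by
  have hs : StarAlgebra.adjoin ℂ s ≤ StarSubalgebra.centralizer ℂ t :=
    StarAlgebra.adjoin_le fun a ha => (StarSubalgebra.mem_centralizer_iff ℂ).2 fun b hb =>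
      ⟨(h a ha b hb).1.symm, (h a ha b hb).2.symm⟩
  have ht := StarAlgebra.adjoin_le_centralizer_centralizer ℂ t hb
  exact ((StarSubalgebra.mem_centralizer_iff ℂ).1 ht a (hs ha)).1

/-- The qubits of a protocol with `q` message qubits in which qubit `j` is not sent but teleported
with the entangled pair `j`; `half (j, false)` is the half of this pair given to the sender and
`half (j, true)` the one given to the receiver. -/
inductive Wire (q : ℕ) where
  | message (j : Fin q)
  | half (i : Fin q × Bool)

namespace MessageSystem

variable {q : ℕ} {H : Type} {K : Type*} [NormedAddCommGroup H] [InnerProductSpace ℂ H]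
  [CompleteSpace H] [NormedAddCommGroup K] [InnerProductSpace ℂ K] [CompleteSpace K]
  (M : MessageSystem q H) (E : EntangledExtension q H K)

/-- The player who holds a qubit throughout the protocol with teleportation. -/
def owner : Wire q → Party
  | .message j => M.sender j
  | .half (j, false) => M.sender j
  | .half (j, true) => (M.sender j).other

/-- The action of matrices on a qubit of the protocol with teleportation. -/
def wire : Wire q → Matrix (Fin 2) (Fin 2) ℂ →⋆ₐ[ℂ] (K →L[ℂ] K)
  | .message j => E.amp.comp (M.qubit j)
  | .half i => E.half i

theorem commute_wire {w w' : Wire q} (h : w ≠ w') (N N' : Matrix (Fin 2) (Fin 2) ℂ) :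
    Commute (M.wire E w N) (M.wire E w' N') := by
  cases w with
  | message i =>
    cases w' with
    | message j => exact (M.commute_qubit i j (fun e => h (e ▸ rfl)) N N').map E.amp
    | half j => exact (E.commute_half_amp j N' _).symm
  | half i =>
    cases w' with
    | message j => exact E.commute_half_amp i N _
    | half j => exact E.commute_half i j (fun e => h (e ▸ rfl)) N N'

theorem commute_amp_wire {T : H →L[ℂ] H} (hT : ∀ j N, Commute T (M.qubit j N)) (w : Wire q)
    (N : Matrix (Fin 2) (Fin 2) ℂ) : Commute (E.amp T) (M.wire E w N) := by
  cases w with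
  | message j => exact (hT j N).map E.amp
  | half i => exact (E.commute_half_amp i N T).symm

/-- The exchange of message qubit `k` with the receiver's half of pair `k`. -/
def swapAt (k : ℕ) : K →L[ℂ] K :=
  if h : k < q then swapOp (M.wire E (.message ⟨k, h⟩)) (M.wire E (.half (⟨k, h⟩, true))) else 1

theorem commute_swapAt {T : K →L[ℂ] K} {k : ℕ}
    (h : ∀ j : Fin q, (j : ℕ) = k → ∀ N,
      Commute T (M.wire E (.message j) N) ∧ Commute T (M.wire E (.half (j, true)) N)) :
    Commute T (M.swapAt E k) := by
  unfold swapAt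
  split_ifs with hk
  · exact commute_swapOp (fun N => (h ⟨k, hk⟩ rfl N).1) fun N => (h ⟨k, hk⟩ rfl N).2
  · exact Commute.one_right T

theorem swapAt_mem_unitary (k : ℕ) : M.swapAt E k ∈ unitary (K →L[ℂ] K) := by
  unfold swapAt
  split_ifs with hk
  · exact swapOp_mem_unitary (M.commute_wire E nofun)
  · exact one_mem _

/-- The exchange of the first `k` message qubits with the receivers' halves. -/
def swaps : ℕ → K →L[ℂ] K
  | 0 => 1
  | k + 1 => M.swapAt E k * swaps k

theorem swaps_mem_unitary (k : ℕ) : M.swaps E k ∈ unitary (K →L[ℂ] K) := by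
  induction k with
  | zero => exact one_mem _
  | succ k ih => exact mul_mem (M.swapAt_mem_unitary E k) ih

theorem commute_swaps {T : K →L[ℂ] K} {k : ℕ}
    (h : ∀ j : Fin q, (j : ℕ) < k → ∀ N,
      Commute T (M.wire E (.message j) N) ∧ Commute T (M.wire E (.half (j, true)) N)) :
    Commute T (M.swaps E k) := by
  induction k with
  | zero => exact Commute.one_right T
  | succ k ih =>
    exact (M.commute_swapAt E fun j hj => h j (by omega)).mul_right
      (ih fun j hj => h j (by omega))

/-- The qubit that plays the role of message qubit `j` after the first `k` teleportations. -/
def carrier (k : ℕ) (j : Fin q) : Wire q :=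
  if (j : ℕ) < k then .half (j, true) else .message j

theorem owner_carrier (k : ℕ) (j : Fin q) : M.owner (carrier k j) = M.holder k j := by
  unfold carrier holder
  split_ifs <;> rfl

theorem swapAt_mul_wire_carrier (k : ℕ) (j : Fin q) (N : Matrix (Fin 2) (Fin 2) ℂ) :
    M.swapAt E k * M.wire E (carrier k j) N =
      M.wire E (carrier (k + 1) j) N * M.swapAt E k := by
  by_cases hj : (j : ℕ) = k
  · subst hj
    have hbefore : carrier (j : ℕ) j = .message j := if_neg (lt_irrefl _)
    have hafter : carrier (j + 1 : ℕ) j = .half (j, true) := if_pos (Nat.lt_succ_self _)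
    rw [hbefore, hafter, swapAt, dif_pos j.is_lt]
    exact swapOp_mul_map (M.commute_wire E (by simp)) N
  · have hcarrier : carrier (k + 1) j = carrier k j :=
      if_congr (by omega) rfl rfl
    rw [hcarrier]
    refine (M.commute_swapAt E fun i hi N' => ⟨M.commute_wire E ?_ N N',
      M.commute_wire E ?_ N N'⟩).symm.eq <;> grind [carrier]

theorem swaps_mul_wire_message (k : ℕ) (j : Fin q) (N : Matrix (Fin 2) (Fin 2) ℂ) :
    M.swaps E k * M.wire E (.message j) N = M.wire E (carrier k j) N * M.swaps E k := by
  induction k with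
  | zero => exact (Commute.one_left _).eq
  | succ k ih => rw [swaps, mul_assoc, ih, ← mul_assoc, swapAt_mul_wire_carrier, mul_assoc]

/-- The operators of round `k`, with each message qubit replaced by its carrier. -/
def relocate (k : ℕ) : (H →L[ℂ] H) →⋆ₐ[ℂ] (K →L[ℂ] K) :=
  ((Unitary.conjStarAlgAut ℂ (K →L[ℂ] K) ⟨M.swaps E k, M.swaps_mem_unitary E k⟩ :
    (K →L[ℂ] K) ≃⋆ₐ[ℂ] (K →L[ℂ] K)) : (K →L[ℂ] K) →⋆ₐ[ℂ] (K →L[ℂ] K)).comp E.amp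

theorem relocate_apply (k : ℕ) (T : H →L[ℂ] H) :
    M.relocate E k T = M.swaps E k * E.amp T * star (M.swaps E k) := rfl

theorem relocate_mul_swaps (k : ℕ) (T : H →L[ℂ] H) :
    M.relocate E k T * M.swaps E k = M.swaps E k * E.amp T := by
  rw [relocate_apply, mul_assoc, (Unitary.mem_iff.1 (M.swaps_mem_unitary E k)).1, mul_one]

theorem relocate_eq_of_swaps_mul {k : ℕ} {T : H →L[ℂ] H} {S : K →L[ℂ] K}
    (h : M.swaps E k * E.amp T = S * M.swaps E k) : M.relocate E k T = S := by
  rw [relocate_apply, h, mul_assoc, (Unitary.mem_iff.1 (M.swaps_mem_unitary E k)).2, mul_one]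

theorem relocate_of_commute (k : ℕ) {T : H →L[ℂ] H} (hT : ∀ j N, Commute T (M.qubit j N)) :
    M.relocate E k T = E.amp T :=
  M.relocate_eq_of_swaps_mul E (M.commute_swaps E fun _ _ N =>
    ⟨M.commute_amp_wire E hT _ N, M.commute_amp_wire E hT _ N⟩).symm.eq

theorem relocate_qubit (k : ℕ) (j : Fin q) (N : Matrix (Fin 2) (Fin 2) ℂ) :
    M.relocate E k (M.qubit j N) = M.wire E (carrier k j) N :=
  M.relocate_eq_of_swaps_mul E (M.swaps_mul_wire_message E k j N)

/-- The operators on the parts that a player holds throughout the protocol with teleportation. -/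
def fixedAlgebra (P : Party) : StarSubalgebra ℂ (K →L[ℂ] K) :=
  StarAlgebra.adjoin ℂ (E.amp '' M.base P ∪ {S | ∃ w, M.owner w = P ∧ ∃ N, S = M.wire E w N})

variable {M} in
theorem wire_mem_fixedAlgebra {P : Party} {w : Wire q} (hw : M.owner w = P)
    (N : Matrix (Fin 2) (Fin 2) ℂ) : M.wire E w N ∈ M.fixedAlgebra E P :=
  StarAlgebra.subset_adjoin ℂ _ (Or.inr ⟨w, hw, N, rfl⟩)

theorem commute_fixedAlgebra {S T : K →L[ℂ] K} (hS : S ∈ M.fixedAlgebra E .alice)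
    (hT : T ∈ M.fixedAlgebra E .bob) : Commute S T := by
  refine commute_of_mem_starAdjoin ?_ hS hT
  rintro _ (⟨S, hS, rfl⟩ | ⟨w, hw, N, rfl⟩) _ (⟨T, hT, rfl⟩ | ⟨w', hw', N', rfl⟩) <;>
    rw [← map_star]
  · exact ⟨(M.commute_base S hS T hT).map E.amp,
      (M.commute_base S hS _ (star_mem hT)).map E.amp⟩
  · have hc := M.commute_amp_wire E (M.commute_base_qubit _ S hS) w'
    exact ⟨hc _, hc _⟩
  · have hc {T} (hT : T ∈ M.base .bob) := M.commute_amp_wire E (M.commute_base_qubit _ T hT) w N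
    exact ⟨(hc hT).symm, (hc (star_mem hT)).symm⟩
  · have hc := M.commute_wire E (w := w) (w' := w') (by grind) N
    exact ⟨hc _, hc _⟩

theorem conj_mul_conj_of_mem_fixedAlgebra {V S W T : K →L[ℂ] K}
    (hV : V ∈ M.fixedAlgebra E .alice) (hS : S ∈ M.fixedAlgebra E .alice)
    (hW : W ∈ M.fixedAlgebra E .bob) (hT : T ∈ M.fixedAlgebra E .bob) :
    star V * S * V * (star W * T * W) = star (V * W) * (S * T * (V * W)) := by
  have hc {S T : K →L[ℂ] K} := M.commute_fixedAlgebra E (S := S) (T := T)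
  rw [mul_assoc (star V), mul_assoc (star W),
    (hc (mul_mem hS hV) (star_mem hW)).mul_mul_mul_comm, (hc hV hT).mul_mul_mul_comm, star_mul,
    (hc (star_mem hV) (star_mem hW)).eq]

theorem relocate_mem_fixedAlgebra {P : Party} {k : ℕ} {T : H →L[ℂ] H}
    (hT : T ∈ M.localAlgebra P k) : M.relocate E k T ∈ M.fixedAlgebra E P := by
  suffices h : M.localAlgebra P k ≤ (M.fixedAlgebra E P).comap (M.relocate E k) from h hT
  refine StarAlgebra.adjoin_le ?_
  rintro S (hS | ⟨j, hj, N, rfl⟩)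
  · change M.relocate E k S ∈ M.fixedAlgebra E P
    rw [M.relocate_of_commute E k (M.commute_base_qubit P S hS)]
    exact StarAlgebra.subset_adjoin ℂ _ (Or.inl ⟨S, hS, rfl⟩)
  · change M.relocate E k (M.qubit j N) ∈ M.fixedAlgebra E P
    rw [relocate_qubit]
    exact wire_mem_fixedAlgebra E ((M.owner_carrier k j).trans hj) N

open Classical in
/-- The projection by which player `P` teleports message qubit `k`; it is `1` unless `P` is the
sender of this qubit. -/
def sendProj (P : Party) (k : ℕ) : K →L[ℂ] K :=
  if h : ∃ hk : k < q, M.sender ⟨k, hk⟩ = P then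
    eprProj (M.wire E (.message ⟨k, h.1⟩)) (M.wire E (.half (⟨k, h.1⟩, false)))
  else 1

open Classical in
/-- The factor by which `sendProj P k` shrinks a state in which pair `k` is entangled. -/
def sendAmplitude (P : Party) (k : ℕ) : ℝ :=
  if ∃ hk : k < q, M.sender ⟨k, hk⟩ = P then 2⁻¹ else 1

theorem sendAmplitude_mul {k : ℕ} (hk : k < q) :
    M.sendAmplitude .alice k * M.sendAmplitude .bob k = 2⁻¹ := by
  cases h : M.sender ⟨k, hk⟩ <;> simp [sendAmplitude, hk, h]

theorem sendProj_mul {k : ℕ} (hk : k < q) :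
    M.sendProj E .alice k * M.sendProj E .bob k =
      eprProj (M.wire E (.message ⟨k, hk⟩)) (M.wire E (.half (⟨k, hk⟩, false))) := by
  cases h : M.sender ⟨k, hk⟩ <;> simp [sendProj, hk, h]

theorem sendProj_mem_fixedAlgebra (P : Party) (k : ℕ) :
    M.sendProj E P k ∈ M.fixedAlgebra E P := by
  unfold sendProj
  split_ifs with h
  · exact SMulMemClass.smul_mem _ (sum_mem fun a _ => sum_mem fun b _ =>
      mul_mem (wire_mem_fixedAlgebra E (w := .message _) h.2 _)
        (wire_mem_fixedAlgebra E (w := .half (_, false)) h.2 _))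
  · exact one_mem _

theorem norm_sendProj_le (P : Party) (k : ℕ) : ‖M.sendProj E P k‖ ≤ 1 := by
  unfold sendProj
  split_ifs with h
  · have hc := M.commute_wire E (w := .message ⟨k, h.1⟩) (w' := .half (⟨k, h.1⟩, false)) nofun
    exact IsStarProjection.norm_le _ ⟨eprProj_mul_self hc, star_eprProj hc⟩
  · exact ContinuousLinearMap.norm_id_le

/-- An operator which does not touch pair `k` leaves it available for teleportation. -/
theorem eprProj_apply_apply_incl {k : ℕ} (hk : k < q) {T : K →L[ℂ] K}
    (hT : ∀ s N, Commute (E.half (⟨k, hk⟩, s) N) T) (v : H) :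
    eprProj (M.wire E (.message ⟨k, hk⟩)) (M.wire E (.half (⟨k, hk⟩, false))) (T (E.incl v)) =
      (2⁻¹ : ℂ) • M.swapAt E k (T (E.incl v)) := by
  have hintact : eprProj (E.half (⟨k, hk⟩, false)) (E.half (⟨k, hk⟩, true)) (T (E.incl v)) =
      T (E.incl v) := by
    rw [← mul_apply_eq_comp, ← (commute_eprProj (fun N => (hT _ N).symm)
      fun N => (hT _ N).symm).eq, mul_apply_eq_comp, E.eprProj_incl]
  have hteleport := congrArg (· (T (E.incl v))) (eprProj_mul_eprProj
    (ρ := M.wire E (.message ⟨k, hk⟩)) (E.commute_half (⟨k, hk⟩, false) (⟨k, hk⟩, true) (by simp)))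
  simpa only [wire, swapAt, hk, dif_pos, mul_apply_eq_comp, smul_apply, hintact,
    Fintype.card_fin, Nat.cast_ofNat] using hteleport

/-- What a player does in the first `k` rounds of the protocol with teleportation if the player
applies the unitaries `U` in the original one. -/
def kraus (P : Party) (U : ℕ → H →L[ℂ] H) : ℕ → K →L[ℂ] K
  | 0 => 1
  | k + 1 => M.sendProj E P k * (M.relocate E k (U k) * kraus P U k)

variable {U V : ℕ → H →L[ℂ] H}

theorem kraus_mem_fixedAlgebra {P : Party} {k : ℕ} (hU : ∀ j < k, U j ∈ M.localAlgebra P j) :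
    M.kraus E P U k ∈ M.fixedAlgebra E P := by
  induction k with
  | zero => exact one_mem _
  | succ k ih =>
    exact mul_mem (M.sendProj_mem_fixedAlgebra E P k) (mul_mem
      (M.relocate_mem_fixedAlgebra E (hU k k.lt_succ_self))
      (ih fun j hj => hU j (hj.trans k.lt_succ_self)))

theorem norm_relocate_apply {k : ℕ} {T : H →L[ℂ] H} (hT : T ∈ unitary (H →L[ℂ] H)) (v : K) :
    ‖M.relocate E k T v‖ = ‖v‖ :=
  ContinuousLinearMap.norm_map_of_mem_unitary (Unitary.map_mem (M.relocate E k) hT) v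

theorem norm_kraus_le {P : Party} {k : ℕ} (hU : ∀ j < k, U j ∈ unitary (H →L[ℂ] H)) :
    ‖M.kraus E P U k‖ ≤ 1 := by
  induction k with
  | zero => exact ContinuousLinearMap.norm_id_le
  | succ k ih =>
    refine ContinuousLinearMap.opNorm_le_bound _ zero_le_one fun v => ?_
    rw [kraus, mul_apply_eq_comp, mul_apply_eq_comp, one_mul]
    calc ‖M.sendProj E P k (M.relocate E k (U k) (M.kraus E P U k v))‖
        ≤ ‖M.relocate E k (U k) (M.kraus E P U k v)‖ :=
          ContinuousLinearMap.le_of_opNorm_le _ (M.norm_sendProj_le E P k) _ |>.trans_eq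
            (one_mul _)
      _ = ‖M.kraus E P U k v‖ := M.norm_relocate_apply E (hU k k.lt_succ_self) _
      _ ≤ ‖v‖ := ContinuousLinearMap.le_of_opNorm_le _
          (ih fun j hj => hU j (hj.trans k.lt_succ_self)) _ |>.trans_eq (one_mul _)

section Intact

variable {i : Fin q × Bool} {k : ℕ} (N : Matrix (Fin 2) (Fin 2) ℂ)

theorem commute_half_swaps (hk : k ≤ i.1) : Commute (E.half i N) (M.swaps E k) :=
  M.commute_swaps E fun j hj N' => ⟨E.commute_half_amp i N _,
    E.commute_half i (j, true) (fun h => by subst h; exact hj.not_ge hk) N N'⟩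

theorem commute_half_relocate (hk : k ≤ i.1) (T : H →L[ℂ] H) :
    Commute (E.half i N) (M.relocate E k T) := by
  have hstar : Commute (E.half i N) (star (M.swaps E k)) := by
    simpa only [map_star, star_star] using (M.commute_half_swaps E (star N) hk).star_star
  exact ((M.commute_half_swaps E N hk).mul_right (E.commute_half_amp i N T)).mul_right hstar

theorem commute_half_sendProj (P : Party) (hk : k < i.1) :
    Commute (E.half i N) (M.sendProj E P k) := by
  unfold sendProj
  split_ifs
  · exact commute_eprProj (fun N' => E.commute_half_amp i N _) fun N' =>
      E.commute_half i _ (fun h => by subst h; exact lt_irrefl _ hk) N N'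
  · exact Commute.one_right _

theorem commute_half_kraus (P : Party) (hk : k ≤ i.1) :
    Commute (E.half i N) (M.kraus E P U k) := by
  induction k with
  | zero => exact Commute.one_right _
  | succ k ih =>
    exact (M.commute_half_sendProj E N P hk).mul_right
      ((M.commute_half_relocate E N (by omega) _).mul_right (ih (by omega)))

end Intact

theorem norm_kraus_succ_incl {P : Party} {k : ℕ} (hU : U k ∈ unitary (H →L[ℂ] H)) (v : H) :
    ‖M.kraus E P U (k + 1) (E.incl v)‖ =
      M.sendAmplitude P k * ‖M.kraus E P U k (E.incl v)‖ := by
  rw [← M.norm_relocate_apply E (k := k) hU (M.kraus E P U k (E.incl v)), ← mul_apply_eq_comp,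
    kraus, mul_apply_eq_comp, sendProj, sendAmplitude]
  split_ifs with h
  · have hc s N : Commute (E.half (⟨k, h.1⟩, s) N) (M.relocate E k (U k) * M.kraus E P U k) :=
      (M.commute_half_relocate E N le_rfl _).mul_right (M.commute_half_kraus E N P le_rfl)
    rw [M.eprProj_apply_apply_incl E h.1 hc, norm_smul, norm_inv, Complex.norm_ofNat,
      ContinuousLinearMap.norm_map_of_mem_unitary (M.swapAt_mem_unitary E k)]
  · rw [one_apply_eq_self, one_mul]

theorem norm_kraus_incl {P : Party} {k : ℕ} (hU : ∀ j < k, U j ∈ unitary (H →L[ℂ] H)) (v : H) :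
    ‖M.kraus E P U k (E.incl v)‖ = (∏ j ∈ Finset.range k, M.sendAmplitude P j) * ‖v‖ := by
  induction k with
  | zero => simp [kraus]
  | succ k ih =>
    rw [M.norm_kraus_succ_incl E (hU k k.lt_succ_self), Finset.prod_range_succ_comm, mul_assoc,
      ih fun j hj => hU j (hj.trans k.lt_succ_self)]

theorem kraus_succ_mul_kraus_succ {k : ℕ} (hk : k < q)
    (hU : ∀ j ≤ k, U j ∈ M.localAlgebra .alice j) (hV : V k ∈ M.localAlgebra .bob k) :
    M.kraus E .alice U (k + 1) * M.kraus E .bob V (k + 1) =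
      eprProj (M.wire E (.message ⟨k, hk⟩)) (M.wire E (.half (⟨k, hk⟩, false))) *
        (M.relocate E k (U k * V k) * (M.kraus E .alice U k * M.kraus E .bob V k)) := by
  have hA := M.relocate_mem_fixedAlgebra E (hU k le_rfl)
  have hB := M.relocate_mem_fixedAlgebra E hV
  have hKA := M.kraus_mem_fixedAlgebra E fun j hj => hU j hj.le
  have hsB := M.sendProj_mem_fixedAlgebra E .bob k
  rw [kraus, kraus, (M.commute_fixedAlgebra E (mul_mem hA hKA) hsB).mul_mul_mul_comm,
    (M.commute_fixedAlgebra E hKA hB).mul_mul_mul_comm, M.sendProj_mul E hk, map_mul]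

end MessageSystem

namespace QuantumProtocol

variable {X Y A B : Type*} [Fintype A] [Fintype B] {q : ℕ} {H : Type} {K : Type*}
  [NormedAddCommGroup H] [InnerProductSpace ℂ H] [CompleteSpace H] [NormedAddCommGroup K]
  [InnerProductSpace ℂ K] [CompleteSpace K] (Q : QuantumProtocol X Y A B q H)
  (E : EntangledExtension q H K)

/-- Alice's part of the protocol with teleportation. -/
def krausA (x : X) (k : ℕ) : K →L[ℂ] K := Q.kraus E .alice (Q.unitaryA · x) k

/-- Bob's part of the protocol with teleportation. -/
def krausB (y : Y) (k : ℕ) : K →L[ℂ] K := Q.kraus E .bob (Q.unitaryB · y) k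

theorem krausA_mem_fixedAlgebra (x : X) : Q.krausA E x q ∈ Q.fixedAlgebra E .alice :=
  Q.kraus_mem_fixedAlgebra E fun j hj => (Q.unitaryA_mem j hj x).2

theorem krausB_mem_fixedAlgebra (y : Y) : Q.krausB E y q ∈ Q.fixedAlgebra E .bob :=
  Q.kraus_mem_fixedAlgebra E fun j hj => (Q.unitaryB_mem j hj y).2

theorem krausA_krausB_incl (x : X) (y : Y) {k : ℕ} (hk : k ≤ q) :
    (Q.krausA E x k * Q.krausB E y k) (E.incl Q.init) =
      (2⁻¹ : ℂ) ^ k • Q.swaps E k (E.incl (Q.state x y k)) := by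
  induction k with
  | zero => simp [krausA, krausB, MessageSystem.kraus, MessageSystem.swaps, state]
  | succ k ih =>
    have hround : Q.relocate E k (Q.unitaryA k x * Q.unitaryB k y)
        (Q.swaps E k (E.incl (Q.state x y k))) = Q.swaps E k (E.incl (Q.state x y (k + 1))) := by
      rw [← mul_apply_eq_comp, Q.relocate_mul_swaps, mul_apply_eq_comp, E.amp_incl]
      rfl
    rw [krausA, krausB, Q.kraus_succ_mul_kraus_succ E hk
      (fun j hj => (Q.unitaryA_mem j (hj.trans_lt hk) x).2) (Q.unitaryB_mem k hk y).2,
      mul_apply_eq_comp, mul_apply_eq_comp]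
    rw [krausA, krausB] at ih
    rw [ih (Nat.le_of_succ_le hk), map_smul, hround, map_smul,
      Q.eprProj_apply_apply_incl E hk fun s N => Q.commute_half_swaps E N le_rfl, smul_smul,
      ← pow_succ]
    rfl

theorem inner_conj_krausA_conj_krausB (x : X) (y : Y) {S T : H →L[ℂ] H}
    (hS : S ∈ Q.localAlgebra .alice q) (hT : T ∈ Q.localAlgebra .bob q) :
    inner ℂ (E.incl Q.init)
      ((star (Q.krausA E x q) * Q.relocate E q S * Q.krausA E x q)
        ((star (Q.krausB E y q) * Q.relocate E q T * Q.krausB E y q) (E.incl Q.init))) =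
      ((2 ^ q)⁻¹ : ℂ) ^ 2 * inner ℂ (Q.state x y q) (S (T (Q.state x y q))) := by
  rw [← mul_apply_eq_comp, Q.conj_mul_conj_of_mem_fixedAlgebra E (Q.krausA_mem_fixedAlgebra E x)
    (Q.relocate_mem_fixedAlgebra E hS) (Q.krausB_mem_fixedAlgebra E y)
    (Q.relocate_mem_fixedAlgebra E hT), mul_apply_eq_comp, ContinuousLinearMap.star_eq_adjoint,
    ContinuousLinearMap.adjoint_inner_right, ← map_mul, mul_apply_eq_comp (Q.relocate E q (S * T)),
    Q.krausA_krausB_incl E x y le_rfl, map_smul, inner_smul_left, inner_smul_right,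
    ← mul_apply_eq_comp, Q.relocate_mul_swaps, mul_apply_eq_comp,
    ContinuousLinearMap.inner_map_map_of_mem_unitary (Q.swaps_mem_unitary E q), E.amp_incl,
    LinearIsometry.inner_map_map, ← mul_assoc, map_pow, map_inv₀, map_ofNat, ← pow_add, ← inv_pow,
    ← pow_mul, mul_two]
  rfl

end QuantumProtocol

/-- A strategy without communication in which both players may abort, and which produces `p` if
neither of them does. On input `x` Alice accepts with the Kraus operator `krausA x`, and then
measures `measA x`. The amplitude of the event that both accept is `N⁻¹`, split as
`ampA * ampB`. -/
structure AbortingStrategy {X Y A B : Type*} [Fintype A] [Fintype B] (p : Behavior X Y A B)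
    (N : ℝ) (K : Type*) [NormedAddCommGroup K] [InnerProductSpace ℂ K] [CompleteSpace K] where
  state : K
  norm_state : ‖state‖ = 1
  krausA : X → K →L[ℂ] K
  krausB : Y → K →L[ℂ] K
  norm_krausA_le : ∀ x, ‖krausA x‖ ≤ 1
  norm_krausB_le : ∀ y, ‖krausB y‖ ≤ 1
  measA : X → A → K →L[ℂ] K
  measB : Y → B → K →L[ℂ] K
  measA_proj : ∀ x, IsProjectiveMeasurement (measA x)
  measB_proj : ∀ y, IsProjectiveMeasurement (measB y)
  ampA : ℝ
  ampB : ℝ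
  ampA_mul_ampB : ampA * ampB = N⁻¹
  norm_krausA_state : ∀ x, ‖krausA x state‖ = ampA
  norm_krausB_state : ∀ y, ‖krausB y state‖ = ampB
  commute_conj : ∀ x y a b, Commute (star (krausA x) * measA x a * krausA x)
    (star (krausB y) * measB y b * krausB y)
  inner_conj : ∀ x y a b, inner ℂ state ((star (krausA x) * measA x a * krausA x)
    ((star (krausB y) * measB y b * krausB y) state)) = (N⁻¹ ^ 2 * p x y a b : ℝ)

theorem SimulableWithQubits.exists_abortingStrategy {X Y A B : Type*} [Fintype A] [Fintype B]
    {p : Behavior X Y A B} {q : ℕ} (h : SimulableWithQubits p q) :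
    ∃ (K : Type) (_ : NormedAddCommGroup K) (_ : InnerProductSpace ℂ K) (_ : CompleteSpace K),
      Nonempty (AbortingStrategy p (2 ^ q) K) := by
  obtain ⟨H, _, _, _, Q, hp⟩ := h
  obtain ⟨K, _, _, _, ⟨E⟩⟩ := exists_entangledExtension q H
  have hA x j (hj : j < q) := (Q.unitaryA_mem j hj x).1
  have hB y j (hj : j < q) := (Q.unitaryB_mem j hj y).1
  refine ⟨K, inferInstance, inferInstance, inferInstance, ⟨{
    state := E.incl Q.init
    norm_state := (E.incl.norm_map _).trans Q.norm_init
    krausA x := Q.krausA E x q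
    krausB y := Q.krausB E y q
    norm_krausA_le x := Q.norm_kraus_le E (hA x)
    norm_krausB_le y := Q.norm_kraus_le E (hB y)
    measA x a := Q.relocate E q (Q.measA x a)
    measB y b := Q.relocate E q (Q.measB y b)
    measA_proj x := (Q.measA_proj x).map _
    measB_proj y := (Q.measB_proj y).map _
    ampA := ∏ j ∈ Finset.range q, Q.sendAmplitude .alice j
    ampB := ∏ j ∈ Finset.range q, Q.sendAmplitude .bob j
    ampA_mul_ampB := ?_
    norm_krausA_state x := by
      rw [QuantumProtocol.krausA, Q.norm_kraus_incl E (hA x), Q.norm_init, mul_one]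
    norm_krausB_state y := by
      rw [QuantumProtocol.krausB, Q.norm_kraus_incl E (hB y), Q.norm_init, mul_one]
    commute_conj x y a b := ?_
    inner_conj x y a b := ?_ }⟩⟩
  · rw [← Finset.prod_mul_distrib, Finset.prod_congr rfl fun j hj =>
      Q.sendAmplitude_mul (Finset.mem_range.1 hj), Finset.prod_const, Finset.card_range, inv_pow]
  · have hkA := Q.krausA_mem_fixedAlgebra E x
    have hkB := Q.krausB_mem_fixedAlgebra E y
    exact Q.commute_fixedAlgebra E
      (mul_mem (mul_mem (star_mem hkA) (Q.relocate_mem_fixedAlgebra E (Q.measA_mem x a))) hkA)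
      (mul_mem (mul_mem (star_mem hkB) (Q.relocate_mem_fixedAlgebra E (Q.measB_mem y b))) hkB)
  · rw [Q.inner_conj_krausA_conj_krausB E x y (Q.measA_mem x a) (Q.measB_mem y b), ← hp]
    push_cast
    rfl

/-! ### Bounds from aborting strategies -/

section AbortMeasurement

variable {A K : Type*} [Fintype A] [NormedAddCommGroup K] [InnerProductSpace ℂ K] [CompleteSpace K]
  {E : A → K →L[ℂ] K} {k : K →L[ℂ] K}

/-- The measurement of a player who accepts with the Kraus operator `k` and then measures `E`; the
outcome `none` means that the player aborts. -/
def abortMeasurement (k : K →L[ℂ] K) (E : A → K →L[ℂ] K) : Option A → K →L[ℂ] K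
  | none => 1 - ∑ a, star k * E a * k
  | some a => star k * E a * k

theorem isPositiveMeasurement_abortMeasurement (hk : ‖k‖ ≤ 1) (hE : IsPositiveMeasurement E) :
    IsPositiveMeasurement (abortMeasurement k E) where
  nonneg
    | none => by
      have hk' : star k * k ≤ 1 := by
        rw [← CStarAlgebra.norm_le_one_iff_of_nonneg _ (star_mul_self_nonneg k),
          CStarRing.norm_star_mul_self]
        exact mul_le_one₀ hk (norm_nonneg k) hk
      rwa [abortMeasurement, ← Finset.sum_mul, ← Finset.mul_sum, hE.sum_eq_one, mul_one,
        sub_nonneg]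
    | some a => star_left_conjugate_nonneg (hE.nonneg a) k
  sum_eq_one := (Fintype.sum_option _).trans (sub_add_cancel _ _)

theorem commute_abortMeasurement {T : K →L[ℂ] K} (h : ∀ a, Commute (star k * E a * k) T)
    (o : Option A) : Commute (abortMeasurement k E o) T := by
  cases o with
  | none => exact (Commute.one_left T).sub_left (Commute.sum_left _ _ _ fun a _ => h a)
  | some a => exact h a

end AbortMeasurement

theorem commute_coarsen {A A' K : Type*} [Fintype A] [DecidableEq A'] [NormedAddCommGroup K]
    [InnerProductSpace ℂ K] {E : A → K →L[ℂ] K} {T : K →L[ℂ] K} (h : ∀ a, Commute (E a) T)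
    (f : A → A') (a' : A') : Commute (coarsen f E a') T :=
  Commute.sum_left _ _ _ fun a _ => h a

theorem IsProjectiveMeasurement.observable_mem_unitary {K : Type*} [NormedAddCommGroup K]
    [InnerProductSpace ℂ K] [CompleteSpace K] {E : ℤˣ → K →L[ℂ] K}
    (hE : IsProjectiveMeasurement E) :
    ∑ a : ℤˣ, ((a : ℤ) : ℂ) • E a ∈ unitary (K →L[ℂ] K) := by
  have hpair (f : ℤˣ → K →L[ℂ] K) : ∑ a, f a = f 1 + f (-1) := by
    rw [UnitsInt.univ, Finset.sum_pair (by decide)]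
  have hdiff : ∑ a : ℤˣ, ((a : ℤ) : ℂ) • E a = E 1 - E (-1) := by
    rw [hpair]
    simp [sub_eq_add_neg]
  have hstar : star (E 1 - E (-1)) = E 1 - E (-1) := by
    rw [star_sub, (hE.selfAdjoint _).star_eq, (hE.selfAdjoint _).star_eq]
  have hsq : (E 1 - E (-1)) * (E 1 - E (-1)) = 1 := by
    rw [sub_mul, mul_sub, mul_sub, hE.idem, hE.idem, hE.orthogonal _ _ (by decide),
      hE.orthogonal _ _ (by decide), ← hE.sum_eq_one, hpair]
    abel
  rw [hdiff, Unitary.mem_iff, hstar, hsq]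
  exact ⟨rfl, rfl⟩

/-- The value of the outcome of `abortMeasurement k E`, with the value `0` for abortion, as an
observable. -/
def abortObservable {K : Type*} [NormedAddCommGroup K] [InnerProductSpace ℂ K] [CompleteSpace K]
    (k : K →L[ℂ] K) (E : ℤˣ → K →L[ℂ] K) : K →L[ℂ] K :=
  ∑ a : ℤˣ, ((a : ℤ) : ℂ) • (star k * E a * k)

theorem norm_abortObservable_apply_le {K : Type*} [NormedAddCommGroup K] [InnerProductSpace ℂ K]
    [CompleteSpace K] {E : ℤˣ → K →L[ℂ] K} (hE : IsProjectiveMeasurement E) {k : K →L[ℂ] K}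
    (hk : ‖k‖ ≤ 1) (v : K) : ‖abortObservable k E v‖ ≤ ‖k v‖ := by
  calc ‖abortObservable k E v‖
    _ = ‖star k ((∑ a : ℤˣ, ((a : ℤ) : ℂ) • E a) (k v))‖ := by
      simp only [abortObservable, sum_apply, smul_apply, mul_apply_eq_comp, map_sum, map_smul]
    _ ≤ ‖(∑ a : ℤˣ, ((a : ℤ) : ℂ) • E a) (k v)‖ :=
      (star k).le_of_opNorm_le ((norm_star k).trans_le hk) _ |>.trans_eq (one_mul _)
    _ = ‖k v‖ := ContinuousLinearMap.norm_map_of_mem_unitary hE.observable_mem_unitary _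

namespace AbortingStrategy

section General

variable {X Y A B : Type*} [Fintype A] [Fintype B] {p : Behavior X Y A B} {N : ℝ} {K : Type}
  [NormedAddCommGroup K] [InnerProductSpace ℂ K] [CompleteSpace K] (S : AbortingStrategy p N K)

/-- Alice's measurement of the shared state, with outcome `none` if she aborts. -/
def abortA (x : X) : Option A → K →L[ℂ] K := abortMeasurement (S.krausA x) (S.measA x)

/-- Bob's measurement of the shared state, with outcome `none` if he aborts. -/
def abortB (y : Y) : Option B → K →L[ℂ] K := abortMeasurement (S.krausB y) (S.measB y)

theorem isPositiveMeasurement_abortA (x : X) : IsPositiveMeasurement (S.abortA x) :=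
  isPositiveMeasurement_abortMeasurement (S.norm_krausA_le x) (S.measA_proj x).isPositiveMeasurement

theorem isPositiveMeasurement_abortB (y : Y) : IsPositiveMeasurement (S.abortB y) :=
  isPositiveMeasurement_abortMeasurement (S.norm_krausB_le y) (S.measB_proj y).isPositiveMeasurement

theorem commute_abort (x : X) (y : Y) (a : Option A) (b : Option B) :
    Commute (S.abortA x a) (S.abortB y b) :=
  commute_abortMeasurement (fun a => (commute_abortMeasurement
    (fun b => (S.commute_conj x y a b).symm) b).symm) a

theorem accepted_measuredBehavior :
    accepted (measuredBehavior S.state S.abortA S.abortB) = N⁻¹ ^ 2 • p := by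
  funext x y a b
  exact congrArg Complex.re (S.inner_conj x y a b)

theorem hasAffineModel (S : AbortingStrategy p N K) (hp : IsNonSignaling p) (hN : 1 ≤ N) :
    HasAffineModel (quantumSet X Y A B) p (2 * N ^ 2 - 1) := by
  classical
  have hN₀ : N ^ 2 ≠ 0 := by positivity
  refine hp.hasAffineModel_of_eq_smul_accepted containsProducts_quantumSet
    (isNonSignaling_measuredBehavior S.norm_state S.isPositiveMeasurement_abortA
      S.isPositiveMeasurement_abortB S.commute_abort) (one_le_pow₀ hN)
    (by rw [S.accepted_measuredBehavior, inv_pow, smul_inv_smul₀ hN₀]) fun a₀ b₀ => ?_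
  rw [postprocess_measuredBehavior]
  exact measuredBehavior_mem_quantumSet S.norm_state
    (fun x => (S.isPositiveMeasurement_abortA x).coarsen _)
    (fun y => (S.isPositiveMeasurement_abortB y).coarsen _) fun x y a b =>
      commute_coarsen (fun a =>
        (commute_coarsen (fun b => (S.commute_abort x y a b).symm) _ b).symm) _ a

end General

section Correlation

variable {X Y : Type*} {C : X → Y → ℝ} {N : ℝ} {K : Type*} [NormedAddCommGroup K]
  [InnerProductSpace ℂ K] [CompleteSpace K] (S : AbortingStrategy (ofCorrelation C) N K)

/-- The image of the shared state under Alice's observable, rescaled to norm at most `1`: since she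
accepts with amplitude `ampA` only, the image itself has norm at most `ampA`. -/
def vectorA (x : X) : K :=
  (S.ampA⁻¹ : ℂ) • abortObservable (S.krausA x) (S.measA x) S.state

/-- The image of the shared state under Bob's observable, rescaled as in `vectorA`. -/
def vectorB (y : Y) : K :=
  (S.ampB⁻¹ : ℂ) • abortObservable (S.krausB y) (S.measB y) S.state

theorem norm_vectorA_le (x : X) : ‖S.vectorA x‖ ≤ 1 := by
  have hle := norm_abortObservable_apply_le (S.measA_proj x) (S.norm_krausA_le x) S.state
  have hpos : 0 ≤ S.ampA := (norm_nonneg _).trans_eq (S.norm_krausA_state x)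
  rw [S.norm_krausA_state] at hle
  rw [vectorA, norm_smul, norm_inv, Complex.norm_of_nonneg hpos]
  exact inv_mul_le_one_of_le₀ hle hpos

theorem norm_vectorB_le (y : Y) : ‖S.vectorB y‖ ≤ 1 := by
  have hle := norm_abortObservable_apply_le (S.measB_proj y) (S.norm_krausB_le y) S.state
  have hpos : 0 ≤ S.ampB := (norm_nonneg _).trans_eq (S.norm_krausB_state y)
  rw [S.norm_krausB_state] at hle
  rw [vectorB, norm_smul, norm_inv, Complex.norm_of_nonneg hpos]
  exact inv_mul_le_one_of_le₀ hle hpos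

theorem inner_abortObservable_abortObservable (x : X) (y : Y) :
    inner ℂ (abortObservable (S.krausA x) (S.measA x) S.state)
      (abortObservable (S.krausB y) (S.measB y) S.state) = (N⁻¹ ^ 2 * C x y : ℝ) := by
  have hsymm (a : ℤˣ) (v : K) :
      inner ℂ ((star (S.krausA x) * S.measA x a * S.krausA x) S.state) v =
        inner ℂ S.state ((star (S.krausA x) * S.measA x a * S.krausA x) v) :=
    ContinuousLinearMap.isSelfAdjoint_iff_isSymmetric.1
      (((S.measA_proj x).selfAdjoint a).conjugate' (S.krausA x)) S.state v
  rw [← sum_ofCorrelation C x y]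
  simp only [abortObservable, sum_apply, smul_apply, sum_inner, inner_sum, inner_smul_left,
    inner_smul_right, hsymm, S.inner_conj, map_intCast, Finset.mul_sum]
  push_cast
  rw [Finset.sum_comm]
  exact Finset.sum_congr rfl fun a _ => Finset.sum_congr rfl fun b _ => by ring

theorem inner_vectorA_vectorB (x : X) (y : Y) :
    inner ℂ (S.vectorA x) (S.vectorB y) = (N⁻¹ * C x y : ℝ) := by
  have hamp : S.ampA⁻¹ * S.ampB⁻¹ = N⁻¹⁻¹ := by rw [← mul_inv, S.ampA_mul_ampB]
  rw [vectorA, vectorB, inner_smul_left, inner_smul_right, S.inner_abortObservable_abortObservable,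
    ← mul_assoc, map_inv₀, Complex.conj_ofReal]
  norm_cast
  rw [hamp, sq, ← mul_assoc, ← mul_assoc, inv_mul_mul_self]

theorem hasAffineModel_ofCorrelation [Finite X] [Finite Y]
    (S : AbortingStrategy (ofCorrelation C) N K) (hN : 1 ≤ N) :
    HasAffineModel (quantumSet X Y ℤˣ ℤˣ) (ofCorrelation C) N := by
  let _ : InnerProductSpace ℝ K := InnerProductSpace.rclikeToReal ℂ K
  have hinner : (fun x y => inner ℝ (S.vectorA x) (S.vectorB y)) = N⁻¹ • C := by
    funext x y
    rw [real_inner_eq_re_inner ℂ, S.inner_vectorA_vectorB]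
    exact Complex.ofReal_re _
  have hinner_neg : (fun x y => inner ℝ (-S.vectorA x) (S.vectorB y)) = -N⁻¹ • C := by
    simp only [inner_neg_left, neg_smul, ← hinner]
    rfl
  refine _root_.hasAffineModel_ofCorrelation hN ?_ ?_
  · rw [← hinner]
    exact ofCorrelation_inner_mem_quantumSet S.norm_vectorA_le S.norm_vectorB_le
  · rw [← hinner_neg]
    exact ofCorrelation_inner_mem_quantumSet
      (fun x => (norm_neg _).trans_le (S.norm_vectorA_le x)) S.norm_vectorB_le

end Correlation

end AbortingStrategy

theorem SimulableWithQubits.hasAffineModel {X Y A B : Type*} [Fintype A] [Fintype B]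
    {p : Behavior X Y A B} (hp : IsNonSignaling p) {q : ℕ} (h : SimulableWithQubits p q) :
    HasAffineModel (quantumSet X Y A B) p (2 ^ (2 * q + 1) - 1) := by
  obtain ⟨K, _, _, _, ⟨S⟩⟩ := h.exists_abortingStrategy
  rw [pow_succ', mul_comm 2 q, pow_mul]
  exact S.hasAffineModel hp (one_le_pow₀ one_le_two)

theorem SimulableWithQubits.hasAffineModel_ofCorrelation {X Y : Type*} [Finite X] [Finite Y]
    {C : X → Y → ℝ} {q : ℕ} (h : SimulableWithQubits (ofCorrelation C) q) :
    HasAffineModel (quantumSet X Y ℤˣ ℤˣ) (ofCorrelation C) (2 ^ q) := by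
  obtain ⟨K, _, _, _, ⟨S⟩⟩ := h.exists_abortingStrategy
  exact S.hasAffineModel_ofCorrelation (one_le_pow₀ one_le_two)

theorem exists_le_of_sInf_le {P : ℕ → Prop} {t : ℕ} (h : sInf {c : ℕ∞ | ∃ s : ℕ, c = s ∧ P s} ≤ t) :
    ∃ s ≤ t, P s := by
  have hne : {c : ℕ∞ | ∃ s : ℕ, c = s ∧ P s}.Nonempty := by
    by_contra hempty
    rw [Set.not_nonempty_iff_eq_empty.1 hempty, sInf_empty] at h
    exact ENat.natCast_ne_top t (top_le_iff.1 h)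
  obtain ⟨s, hs, hP⟩ := csInf_mem hne
  exact ⟨s, by rwa [hs, Nat.cast_le] at h, hP⟩

end

theorem mainTheorem1 {X Y A B : Type*} [Finite X] [Finite Y] [Fintype A] [Fintype B]
    [DecidableEq A] [DecidableEq B]
    (p : Behavior X Y A B) (hp : IsNonSignaling p)
    (C : X → Y → ℝ) (hC : ∀ x y, C x y ∈ Set.Icc (-1 : ℝ) 1) (t q : ℕ) :
    (publicCoinComplexity p ≤ t →
      nuTilde p ≤ (((2 : ℝ) ^ (t + 1) - 1 : ℝ) : EReal)) ∧
    (publicCoinComplexity (ofCorrelation C) ≤ t →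
      nuTilde (ofCorrelation C) ≤ (((2 : ℝ) ^ t : ℝ) : EReal)) ∧
    (entangledComplexity p ≤ q →
      gammaTwoTilde p ≤ (((2 : ℝ) ^ (2 * q + 1) - 1 : ℝ) : EReal)) ∧
    (entangledComplexity (ofCorrelation C) ≤ q →
      gammaTwoTilde (ofCorrelation C) ≤ (((2 : ℝ) ^ q : ℝ) : EReal)) := by
  have hpow {m n : ℕ} (h : m ≤ n) : (2 : ℝ) ^ m ≤ 2 ^ n := pow_le_pow_right₀ one_le_two h
  refine ⟨fun h => ?_, fun h => ?_, fun h => ?_, fun h => ?_⟩ <;>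
    obtain ⟨s, hs, hsim⟩ := exists_le_of_sInf_le h
  · exact ((hsim.hasAffineModel hp).mono (sub_le_sub_right (hpow (by omega)) 1)).affineCost_le
  · exact (hsim.hasAffineModel_ofCorrelation.mono (hpow hs)).affineCost_le
  · exact ((hsim.hasAffineModel hp).mono (sub_le_sub_right (hpow (by omega)) 1)).affineCost_le
  · exact (hsim.hasAffineModel_ofCorrelation.mono (hpow hs)).affineCost_le
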